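/- Let $n\ge 1$, let $\Gamma_+=\{\kappa\in\mathbb R^n:\kappa_i>0 \text{ for all } i\}$, and let $f:\Gamma_+\to\mathbb R$ be smooth, symmetric, strictly increasing in each argument ($\partial f/\partial\kappa_i>0$), homogeneous of degree one, positive, and normalised by $f(1,\dots,1)=1$. Put $f_*(x_1,\dots,x_n)=f(x_1^{-1},\dots,x_n^{-1})^{-1}$, extended continuously to $\overline{\Gamma_+}$, and $\hat f(x)=f(x,1,\dots,1)$ for $x>0$; let $\chi$ be the inverse function of $\hat f$. Consider the flow of hypersurfaces in $\mathbb R^{n+1}$ whose inward normal speed is $f(\kappa)$, where $\kappa$ is the vector of principal curvatures (the case $\alpha=1$). A smooth subsolution (supersolution) on $[a,b]$ is a family of closed sets with smooth boundary depending smoothly on time, with $\kappa\in\Gamma_+$ at each boundary point, and with inward normal velocity at least (at most) $f(\kappa)$. A family $(\Omega_t)_{0\le t\le T}$ of subsets of $\mathbb R^{n+1}$ is a barrier solution if for every $[a,b]\subset[0,T]$ each smooth subsolution $\Omega'$ on $[a,b]$ with $\Omega'_a\subset\Omega_a$ satisfies $\Omega'_t\subset\Omega_t$ on $[a,b]$,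 and each smooth supersolution $\Omega''$ on $[a,b]$ with $\Omega_a\subset\Omega''_a$ satisfies $\Omega_t\subset\Omega''_t$ on $[a,b]$. Write $M_t=\partial\Omega_t$ and $s(z,t)=\sup\{\langle y,z\rangle:y\in\Omega_t\}$ for $z\in\mathbb S^n$. Let $\Omega_0$ be bounded and convex with nonempty interior, and let $R_+$ be its circumradius. Flat sides move if and only if $f_*=0$ on $\partial\Gamma_+$, in the following sense. (1) If $f_*=0$ on $\partial\Gamma_+$, then for every barrier solution $(\Omega_t)_{0\le t\le T}$ and every $t\in(0,T]$ with $\Omega_t\neq\emptyset$, the set $\Omega_t$ is bounded, $3R_+^2/t$ lies in the range of $\hat f$, and for all $z\in\mathbb S^n$ $$s(z,t)\le s(z,0)-R_+\,3^{-\chi(3R_+^2/t)}.$$ (2) If $f_*$ does not vanish identically on $\partial\Gamma_+$, then there is a constant $C>0$, depending only on $f$, such that for every barrier solution $(\Omega_t)_{0\le t\le T}$: if $z\in\mathbb S^n$ and $y_0\in M_0$ satisfy $\langle y_0,z\rangle=s(z,0)$ and, for some $r>0$, the hemisphere $B_r(y_0)\cap\{y:\langle y,z\rangle<s(z,0)\}$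 is contained in $\Omega_0$, then $y_0\in M_t$ for $0\le t\le\min\{Cr^2,T\}$. -/

import Mathlib

open Set Filter Topology
open scoped ContDiff

noncomputable section

namespace CurvatureFlow

/-- The ambient Euclidean space `ℝⁿ⁺¹` of the evolving hypersurfaces. -/
abbrev Space (n : ℕ) : Type := EuclideanSpace ℝ (Fin (n + 1))

/-- The open positive cone in `ℝⁿ`. -/
def posCone (n : ℕ) : Set (Fin n → ℝ) := {κ | ∀ i, 0 < κ i}

/-- The standing conditions on the speed function `f`, a function on the positive cone (its values
elsewhere play no role): smooth, symmetric, strictly increasing in each argument, homogeneous of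
degree one, positive and normalised. -/
structure IsSpeed {n : ℕ} (f : (Fin n → ℝ) → ℝ) : Prop where
  smooth : ContDiffOn ℝ ∞ f (posCone n)
  symm : ∀ κ ∈ posCone n, ∀ σ : Equiv.Perm (Fin n), f (fun i => κ (σ i)) = f κ
  deriv_pos : ∀ κ ∈ posCone n, ∀ i, 0 < fderiv ℝ f κ (Pi.single i 1)
  homog : ∀ κ ∈ posCone n, ∀ c : ℝ, 0 < c → f (c • κ) = c * f κ
  pos : ∀ κ ∈ posCone n, 0 < f κ
  normalised : f (fun _ => 1) = 1

/-- The dual function `f_*(x₁, …, xₙ) = f(x₁⁻¹, …, xₙ⁻¹)⁻¹`. -/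
def dual {n : ℕ} (f : (Fin n → ℝ) → ℝ) (x : Fin n → ℝ) : ℝ := (f (fun i => (x i)⁻¹))⁻¹

/-- `f_*`, extended continuously from the positive cone to its closure, vanishes on the boundary of
the cone. -/
def DualVanishesOnBoundary {n : ℕ} (f : (Fin n → ℝ) → ℝ) : Prop :=
  ∀ x ∈ frontier (posCone n), Tendsto (dual f) (𝓝[posCone n] x) (𝓝 0)

/-- The function `x ↦ f(x, 1, …, 1)`. -/
def fhat {n : ℕ} (f : (Fin n → ℝ) → ℝ) (x : ℝ) : ℝ := f (fun i => if (i : ℕ) = 0 then x else 1)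

/-- `χ`, the inverse of the function `fhat f : (0, ∞) → ℝ`, with an arbitrary value outside the
range of that function. -/
def chi {n : ℕ} (f : (Fin n → ℝ) → ℝ) (ξ : ℝ) : ℝ := Function.invFunOn (fhat f) (Ioi 0) ξ

/-- `Ω` is a family of sets (only the times in `[a, b]` matter), `t ∈ [a, b]`, and `p` is a point of
`∂(Ω t)`. The predicate says that near `(p, t)` the family is the sublevel set `{φ ≤ 0}` of
a smooth function `φ` of space and time with non-vanishing spatial gradient (so near `p` the sets
have a smooth boundary, depending smoothly on time), that `κ` are the principal curvatures of
`∂(Ω t)` at `p`, listed in some order, and that `V` is the inward normal velocity there.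

The outer unit normal is `∇φ / ‖∇φ‖`, the second fundamental form is the restriction of
`D²φ / ‖∇φ‖` to the tangent space (positive on the boundary of a ball), `e` is an
orthonormal basis of principal directions of the tangent space, and the inward velocity is
`∂ₜφ / ‖∇φ‖`. -/
def HasBoundaryData {n : ℕ} (Ω : ℝ → Set (Space n)) (a b : ℝ) (p : Space n) (t : ℝ)
    (κ : Fin n → ℝ) (V : ℝ) : Prop :=
  ∃ (φ : Space n × ℝ → ℝ) (U : Set (Space n × ℝ)),
    IsOpen U ∧ (p, t) ∈ U ∧ ContDiffOn ℝ ∞ φ U ∧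
    (∀ q ∈ U, q.2 ∈ Icc a b → (q.1 ∈ Ω q.2 ↔ φ q ≤ 0)) ∧
    φ (p, t) = 0 ∧
    gradient (fun x => φ (x, t)) p ≠ 0 ∧
    (∃ e : Fin n → Space n, Orthonormal ℝ e ∧
      (∀ i, inner ℝ (gradient (fun x => φ (x, t)) p) (e i) = 0) ∧
      ∀ i j, fderiv ℝ (fderiv ℝ (fun x => φ (x, t))) p (e i) (e j) =
        if i = j then κ i * ‖gradient (fun x => φ (x, t)) p‖ else 0) ∧
    V = deriv (fun τ => φ (p, τ)) t / ‖gradient (fun x => φ (x, t)) p‖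

/-- A family of closed sets over the time interval `[a, b]` with smooth boundary depending smoothly
on time, whose principal curvatures `κ` lie in the positive cone and whose inward normal velocity
`V` satisfies `rel V κ` at each boundary point. The fields `inside` and `outside` say that no part
of a set appears or disappears suddenly: interior and exterior points remain so for nearby times. -/
structure IsSmoothEvolution {n : ℕ} (rel : ℝ → (Fin n → ℝ) → Prop) (Ω : ℝ → Set (Space n))
    (a b : ℝ) : Prop where
  closed : ∀ t ∈ Icc a b, IsClosed (Ω t)
  inside : ∀ t ∈ Icc a b, ∀ p ∈ interior (Ω t),
    ∀ᶠ q : Space n × ℝ in 𝓝 (p, t), q.2 ∈ Icc a b → q.1 ∈ Ω q.2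
  outside : ∀ t ∈ Icc a b, ∀ p ∉ Ω t,
    ∀ᶠ q : Space n × ℝ in 𝓝 (p, t), q.2 ∈ Icc a b → q.1 ∉ Ω q.2
  boundary : ∀ t ∈ Icc a b, ∀ p ∈ frontier (Ω t),
    ∃ (κ : Fin n → ℝ) (V : ℝ), HasBoundaryData Ω a b p t κ V ∧ κ ∈ posCone n ∧ rel V κ

/-- Smooth subsolutions of the flow with speed `f`: the inward normal velocity is at least
`f(κ)`. -/
def IsSubsolution {n : ℕ} (f : (Fin n → ℝ) → ℝ) (Ω : ℝ → Set (Space n)) (a b : ℝ) : Prop :=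
  IsSmoothEvolution (fun V κ => f κ ≤ V) Ω a b

/-- Smooth supersolutions of the flow with speed `f`: the inward normal velocity is at most
`f(κ)`. -/
def IsSupersolution {n : ℕ} (f : (Fin n → ℝ) → ℝ) (Ω : ℝ → Set (Space n)) (a b : ℝ) : Prop :=
  IsSmoothEvolution (fun V κ => V ≤ f κ) Ω a b

/-- Outer barriers on a time interval `I`: a smooth subsolution that starts inside stays inside. -/
def IsOuterBarrier {n : ℕ} (f : (Fin n → ℝ) → ℝ) (A : ℝ → Set (Space n)) (I : Set ℝ) : Prop :=
  ∀ a b : ℝ, a < b → Icc a b ⊆ I → ∀ Ω : ℝ → Set (Space n), IsSubsolution f Ω a b →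
    Ω a ⊆ A a → ∀ t ∈ Icc a b, Ω t ⊆ A t

/-- Inner barriers on a time interval `I`: they stay inside each smooth supersolution in which they
start. -/
def IsInnerBarrier {n : ℕ} (f : (Fin n → ℝ) → ℝ) (A : ℝ → Set (Space n)) (I : Set ℝ) : Prop :=
  ∀ a b : ℝ, a < b → Icc a b ⊆ I → ∀ Ω : ℝ → Set (Space n), IsSupersolution f Ω a b →
    A a ⊆ Ω a → ∀ t ∈ Icc a b, A t ⊆ Ω t

/-- Barrier solutions of the flow with speed `f` on a time interval `I`. -/
def IsBarrierSolution {n : ℕ} (f : (Fin n → ℝ) → ℝ) (A : ℝ → Set (Space n)) (I : Set ℝ) : Prop :=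
  IsOuterBarrier f A I ∧ IsInnerBarrier f A I

/-- The support function `s(z) = sup {⟨y, z⟩ : y ∈ K}` of a bounded nonempty set. -/
def supportFn {n : ℕ} (K : Set (Space n)) (z : Space n) : ℝ :=
  sSup ((fun y => inner ℝ y z) '' K)

/-- The circumradius of a bounded set: the infimum of the radii of the balls that contain it. -/
def circumradius {n : ℕ} (K : Set (Space n)) : ℝ :=
  sInf {R : ℝ | 0 ≤ R ∧ ∃ c : Space n, K ⊆ Metric.closedBall c R}

end CurvatureFlow

end

/-!
Both halves compare a barrier solution with explicit hypersurfaces of revolution about an axis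
parallel to `z`, whose principal curvatures have the form `(x, y, …, y)`, so that the speed there
is `y * fhat f (x / y)`; vanishing of `f_*` on the boundary of the cone means that `fhat f` is
unbounded.

If `fhat f` is bounded by `K`, a thin ellipsoid of revolution inside the hemisphere, centred at a
small depth below `y₀`, can be made to shrink fast enough to be a subsolution and still slowly
enough to cover its centre for a time of order `r² / K`. Letting the depth tend to zero keeps `y₀`
in the closure of the solution; a large sphere that nearly touches the supporting half-space
prevents `y₀` from entering the interior.

If `fhat f` is unbounded, shrinking spheres confine the solution to a cylinder of radius about
`R₊` and give `2 t ≤ R₊²`. Over that cylinder the graph of a multiple of `exp √(1 + l² s)`, with `s`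
the squared distance to the axis and a coefficient that grows exponentially in time, has curvature
ratio at most `χ` and moves downwards no faster than the flow; with `fhat f χ = 3 R₊² / t` it has
descended by at least `R₊ 3^(-χ)` at time `t`.
-/

namespace CurvatureFlow

theorem monotoneOn_of_fderiv_single_nonneg {ι : Type*} [Finite ι] [DecidableEq ι]
    {S : Set (ι → ℝ)} {f : (ι → ℝ) → ℝ} (hS : Convex ℝ S) (hf : ∀ x ∈ S, DifferentiableAt ℝ f x)
    (hf' : ∀ x ∈ S, ∀ i, 0 ≤ fderiv ℝ f x (Pi.single i 1)) : MonotoneOn f S := by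
  intro x hx y hy hxy
  have := Fintype.ofFinite ι
  obtain ⟨w, hw, hfw⟩ :=
    domain_mvt (fun v hv => (hf v hv).hasFDerivAt.hasFDerivWithinAt) hS hx hy
  have hsum : fderiv ℝ f w (y - x) = ∑ i, (y i - x i) * fderiv ℝ f w (Pi.single i 1) := by
    conv_lhs => rw [← Finset.univ_sum_single (y - x), map_sum]
    refine Finset.sum_congr rfl fun i _ => ?_
    rw [← smul_eq_mul, ← map_smul, ← Pi.single_smul, Pi.sub_apply, smul_eq_mul, mul_one]
  refine sub_nonneg.1 (hfw ▸ hsum ▸ Finset.sum_nonneg fun i _ => ?_)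
  exact mul_nonneg (sub_nonneg.2 (hxy i)) (hf' w (hS.segment_subset hx hy hw) i)

/-- The vector `(x, y, …, y)`: the principal curvatures of a hypersurface of revolution. -/
def axisVec {n : ℕ} (x y : ℝ) : Fin n → ℝ := fun i => if (i : ℕ) = 0 then x else y

theorem axisVec_mem_posCone {n : ℕ} {x y : ℝ} (hx : 0 < x) (hy : 0 < y) :
    (axisVec x y : Fin n → ℝ) ∈ posCone n := fun i => by
  unfold axisVec
  split_ifs <;> assumption

theorem axisVec_le_axisVec {n : ℕ} {x x' y y' : ℝ} (hx : x ≤ x') (hy : y ≤ y') :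
    (axisVec x y : Fin n → ℝ) ≤ axisVec x' y' := fun i => by
  unfold axisVec
  split_ifs <;> assumption

theorem smul_axisVec {n : ℕ} (c x y : ℝ) :
    c • (axisVec x y : Fin n → ℝ) = axisVec (c * x) (c * y) := by
  ext i
  simp only [axisVec, Pi.smul_apply, smul_eq_mul, mul_ite]

theorem continuous_axisVec_left {n : ℕ} (y : ℝ) :
    Continuous fun x => (axisVec x y : Fin n → ℝ) := by
  refine continuous_pi fun i => ?_
  unfold axisVec
  split_ifs <;> fun_prop

theorem posCone_eq_pi (n : ℕ) : posCone n = univ.pi fun _ => Ioi 0 := by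
  ext κ
  simp only [posCone, mem_ofPred_eq, mem_univ_pi, mem_Ioi]

theorem isOpen_posCone (n : ℕ) : IsOpen (posCone n) :=
  posCone_eq_pi n ▸ isOpen_set_pi finite_univ fun _ _ => isOpen_Ioi

theorem convex_posCone (n : ℕ) : Convex ℝ (posCone n) :=
  posCone_eq_pi n ▸ convex_pi fun _ _ => convex_Ioi 0

theorem axisVec_zero_mem_frontier_posCone {n : ℕ} (hn : 0 < n) {y : ℝ} (hy : 0 < y) :
    (axisVec 0 y : Fin n → ℝ) ∈ frontier (posCone n) := by
  rw [(isOpen_posCone n).frontier_eq]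
  refine ⟨mem_closure_of_tendsto (b := 𝓝[>] 0)
    ((continuous_axisVec_left y).continuousAt.mono_left nhdsWithin_le_nhds)
    (eventually_mem_nhdsWithin.mono fun x hx => axisVec_mem_posCone hx hy), fun h => ?_⟩
  simpa [axisVec] using h ⟨0, hn⟩

theorem dual_axisVec {n : ℕ} (f : (Fin n → ℝ) → ℝ) (x : ℝ) :
    dual f (axisVec x 1) = (fhat f x⁻¹)⁻¹ := by
  unfold dual fhat axisVec
  congr 2
  ext i
  split_ifs <;> simp only [inv_one]

namespace IsSpeed

variable {n : ℕ} {f : (Fin n → ℝ) → ℝ}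

theorem dim_pos (hf : IsSpeed f) : 0 < n := by
  refine Nat.pos_of_ne_zero fun hn => ?_
  subst hn
  have h0 : (0 : Fin 0 → ℝ) ∈ posCone 0 := fun i => i.elim0
  have hpos := hf.pos 0 h0
  have hhom := hf.homog 0 h0 2 two_pos
  rw [smul_zero] at hhom
  linarith

theorem monotoneOn (hf : IsSpeed f) : MonotoneOn f (posCone n) :=
  monotoneOn_of_fderiv_single_nonneg (convex_posCone n)
    (fun x hx => (hf.smooth.contDiffAt ((isOpen_posCone n).mem_nhds hx)).differentiableAt
      (by simp))
    fun x hx i => (hf.deriv_pos x hx i).le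

theorem apply_axisVec_le_apply_axisVec (hf : IsSpeed f) {x x' y y' : ℝ} (hx : 0 < x) (hy : 0 < y)
    (hxx' : x ≤ x') (hyy' : y ≤ y') : f (axisVec x y) ≤ f (axisVec x' y') :=
  hf.monotoneOn (axisVec_mem_posCone hx hy)
    (axisVec_mem_posCone (hx.trans_le hxx') (hy.trans_le hyy')) (axisVec_le_axisVec hxx' hyy')

theorem apply_axisVec (hf : IsSpeed f) {x y : ℝ} (hx : 0 < x) (hy : 0 < y) :
    f (axisVec x y) = y * fhat f (x / y) := by
  have h := hf.homog (axisVec (x / y) 1) (axisVec_mem_posCone (div_pos hx hy) one_pos) y hy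
  rwa [smul_axisVec, mul_div_cancel₀ x hy.ne', mul_one] at h

theorem fhat_one (hf : IsSpeed f) : fhat f 1 = 1 := by
  simpa only [fhat, ite_self] using hf.normalised

theorem apply_axisVec_self (hf : IsSpeed f) {x : ℝ} (hx : 0 < x) : f (axisVec x x) = x := by
  rw [hf.apply_axisVec hx hx, div_self hx.ne', hf.fhat_one, mul_one]

theorem fhat_pos (hf : IsSpeed f) {x : ℝ} (hx : 0 < x) : 0 < fhat f x :=
  hf.pos (axisVec x 1) (axisVec_mem_posCone hx one_pos)

theorem monotoneOn_fhat (hf : IsSpeed f) : MonotoneOn (fhat f) (Ioi 0) :=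
  fun _ hx _ _ hxy => hf.apply_axisVec_le_apply_axisVec hx one_pos hxy le_rfl

theorem fhat_le_self (hf : IsSpeed f) {x : ℝ} (hx : 1 ≤ x) : fhat f x ≤ x := by
  have hx0 : 0 < x := one_pos.trans_le hx
  exact (hf.apply_axisVec_le_apply_axisVec hx0 one_pos le_rfl hx).trans_eq
    (hf.apply_axisVec_self hx0)

theorem mul_fhat_div_le_apply_axisVec (hf : IsSpeed f) {x y ξ : ℝ} (hx : 0 < x) (hξ : 0 < ξ)
    (h : x ≤ ξ * y) : x * fhat f ξ / ξ ≤ f (axisVec x y) := by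
  have hy : 0 < x / ξ := div_pos hx hξ
  calc x * fhat f ξ / ξ = x / ξ * fhat f (x / (x / ξ)) := by
        rw [div_div_cancel₀ hx.ne', mul_div_right_comm]
    _ = f (axisVec x (x / ξ)) := (hf.apply_axisVec hx hy).symm
    _ ≤ f (axisVec x y) :=
        hf.apply_axisVec_le_apply_axisVec hx hy le_rfl ((div_le_iff₀' hξ).2 h)

theorem continuousOn_fhat (hf : IsSpeed f) : ContinuousOn (fhat f) (Ioi 0) :=
  hf.smooth.continuousOn.comp (continuous_axisVec_left 1).continuousOn
    fun _ hx => axisVec_mem_posCone hx one_pos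

theorem tendsto_fhat_atTop (hf : IsSpeed f) (hv : DualVanishesOnBoundary f) :
    Tendsto (fhat f) atTop atTop := by
  have hpath : Tendsto (fun x : ℝ => (axisVec x⁻¹ 1 : Fin n → ℝ)) atTop
      (𝓝[posCone n] axisVec 0 1) :=
    tendsto_nhdsWithin_iff.2
      ⟨(continuous_axisVec_left 1).continuousAt.tendsto.comp tendsto_inv_atTop_zero,
        (eventually_gt_atTop 0).mono fun x hx => axisVec_mem_posCone (inv_pos.2 hx) one_pos⟩
  have hdual := (hv _ (axisVec_zero_mem_frontier_posCone hf.dim_pos one_pos)).comp hpath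
  simp only [Function.comp_def, dual_axisVec, inv_inv] at hdual
  have hinv := tendsto_nhdsWithin_iff.2 ⟨hdual,
    (eventually_gt_atTop 0).mono fun x hx => mem_Ioi.2 (inv_pos.2 (hf.fhat_pos hx))⟩
  simpa only [Pi.inv_def, inv_inv] using hinv.inv_tendsto_nhdsGT_zero

theorem Ici_one_subset_image_fhat (hf : IsSpeed f) (hv : DualVanishesOnBoundary f) :
    Ici 1 ⊆ fhat f '' Ioi 0 := by
  have hivt := isPreconnected_Ioi.intermediate_value_Ici (mem_Ioi.2 one_pos)
    (le_principal_iff.2 (Ioi_mem_atTop 0)) hf.continuousOn_fhat (hf.tendsto_fhat_atTop hv)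
  rwa [hf.fhat_one] at hivt

theorem dual_le (hf : IsSpeed f) {x : Fin n → ℝ} (hx : x ∈ posCone n) {L ξ : ℝ} (hξ : 0 < ξ)
    {i₀ : Fin n} (hL : ∀ i, x i ≤ L) (hi₀ : x i₀ * ξ ≤ L) : dual f x ≤ L / fhat f ξ := by
  have hL0 : 0 < L := (hx i₀).trans_le (hL i₀)
  have hinv : (fun i => (x i)⁻¹) ∈ posCone n := fun i => inv_pos.2 (hx i)
  let σ : Equiv.Perm (Fin n) := Equiv.swap ⟨0, i₀.pos⟩ i₀
  have hle : (axisVec (ξ / L) (1 / L) : Fin n → ℝ) ≤ fun i => (x (σ i))⁻¹ := fun i => by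
    unfold axisVec
    split_ifs with hi
    · obtain rfl : i = ⟨0, i₀.pos⟩ := Fin.ext hi
      simp only [σ, Equiv.swap_apply_left]
      rw [div_le_iff₀ hL0, ← div_eq_inv_mul, le_div_iff₀' (hx i₀)]
      exact hi₀
    · rw [one_div]
      exact inv_anti₀ (hx _) (hL _)
  have hf_le : fhat f ξ / L ≤ f (fun i => (x i)⁻¹) := by
    calc fhat f ξ / L = f (axisVec (ξ / L) (1 / L)) := by
          rw [hf.apply_axisVec (by positivity) (by positivity),
            div_div_div_cancel_right₀ hL0.ne', div_one, one_div_mul_eq_div]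
      _ ≤ f (fun i => (x (σ i))⁻¹) :=
          hf.monotoneOn (axisVec_mem_posCone (by positivity) (by positivity))
            (fun i => hinv (σ i)) hle
      _ = f (fun i => (x i)⁻¹) := hf.symm _ hinv σ
  rw [← inv_div]
  exact inv_anti₀ (div_pos (hf.fhat_pos hξ) hL0) hf_le

theorem dualVanishesOnBoundary_of_tendsto_fhat (hf : IsSpeed f)
    (h : Tendsto (fhat f) atTop atTop) : DualVanishesOnBoundary f := by
  intro p hp
  rw [(isOpen_posCone n).frontier_eq] at hp
  obtain ⟨i₀, hi₀⟩ : ∃ i, p i ≤ 0 := by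
    by_contra! hpos
    exact hp.2 hpos
  have hL : 0 < ‖p‖ + 1 := by positivity
  refine Metric.tendsto_nhds.2 fun ε hε => ?_
  obtain ⟨ξ, hξ, hfξ⟩ := ((eventually_gt_atTop 0).and
    (h.eventually_gt_atTop ((‖p‖ + 1) / ε))).exists
  have hcoord : ∀ i {c : ℝ}, p i < c → ∀ᶠ q in 𝓝[posCone n] p, q i < c := fun i c hc =>
    nhdsWithin_le_nhds ((continuous_apply i).continuousAt.eventually_lt_const hc)
  filter_upwards [eventually_mem_nhdsWithin,
    eventually_all.2 fun i => hcoord i <|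
      (le_abs_self _).trans_lt ((norm_le_pi_norm p i).trans_lt (lt_add_one _)),
    hcoord i₀ (hi₀.trans_lt (div_pos hL hξ))] with q hq hqL hq₀
  have hdual : 0 < dual f q := inv_pos.2 (hf.pos _ fun i => inv_pos.2 (hq i))
  rw [Real.dist_0_eq_abs, abs_of_pos hdual]
  calc dual f q ≤ (‖p‖ + 1) / fhat f ξ :=
        hf.dual_le hq hξ (fun i => (hqL i).le) ((lt_div_iff₀ hξ).1 hq₀).le
    _ < ε := (div_lt_comm₀ hε (hf.fhat_pos hξ)).1 hfξ

theorem exists_fhat_le (hf : IsSpeed f) (hv : ¬ DualVanishesOnBoundary f) :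
    ∃ K, ∀ x, 0 < x → fhat f x ≤ K := by
  by_contra! h
  refine hv (hf.dualVanishesOnBoundary_of_tendsto_fhat (tendsto_atTop_atTop.2 fun K => ?_))
  obtain ⟨x, hx, hK⟩ := h K
  exact ⟨x, fun y hxy => hK.le.trans (hf.monotoneOn_fhat hx (hx.trans_le hxy) hxy)⟩

theorem le_chi (hf : IsSpeed f) {ξ : ℝ} (h1 : 1 < ξ) (hξ : ξ ∈ fhat f '' Ioi 0) :
    ξ ≤ chi f ξ := by
  have hpos : 0 < chi f ξ := Function.invFunOn_mem hξ
  have hval : fhat f (chi f ξ) = ξ := Function.invFunOn_eq hξ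
  have hone : 1 ≤ chi f ξ := by
    by_contra! hlt
    have := hf.monotoneOn_fhat hpos (mem_Ioi.2 one_pos) hlt.le
    rw [hval, hf.fhat_one] at this
    exact this.not_gt h1
  exact hval.symm.le.trans (hf.fhat_le_self hone)

end IsSpeed

section Revolution

variable {E : Type*} [NormedAddCommGroup E] [InnerProductSpace ℝ E] {c z p : E}

/-- The displacement of `p` from the axis through `c` in the direction of the unit vector `z`. -/
noncomputable def axisOffset (c z p : E) : E := (p - c) - inner ℝ z (p - c) • z

/-- The squared distance of `p` from the axis through `c` in the direction of the unit
vector `z`. -/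
noncomputable def axisDistSq (c z p : E) : ℝ := ‖p - c‖ ^ 2 - inner ℝ z (p - c) ^ 2

theorem inner_axisOffset (hz : ‖z‖ = 1) : inner ℝ z (axisOffset c z p) = 0 := by
  rw [axisOffset, inner_sub_right, real_inner_smul_right, real_inner_self_eq_norm_sq, hz]
  ring

theorem norm_axisOffset_sq (hz : ‖z‖ = 1) : ‖axisOffset c z p‖ ^ 2 = axisDistSq c z p := by
  rw [axisDistSq, axisOffset, norm_sub_sq_real, norm_smul, mul_pow, hz, Real.norm_eq_abs, sq_abs,
    real_inner_smul_right, real_inner_comm]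
  ring

theorem axisDistSq_nonneg (hz : ‖z‖ = 1) : 0 ≤ axisDistSq c z p :=
  norm_axisOffset_sq (c := c) (p := p) hz ▸ sq_nonneg _

theorem contDiff_axisDistSq {k : WithTop ℕ∞} : ContDiff ℝ k (axisDistSq c z) :=
  ((contDiff_id.sub contDiff_const).norm_sq ℝ).sub
    ((contDiff_const.inner ℝ (contDiff_id.sub contDiff_const)).pow 2)

theorem hasFDerivAt_inner_sub_const :
    HasFDerivAt (fun p => inner ℝ z (p - c)) (innerSL ℝ z) p :=
  (innerSL ℝ z).hasFDerivAt.comp p ((hasFDerivAt_id p).sub_const c)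

theorem hasFDerivAt_axisDistSq :
    HasFDerivAt (axisDistSq c z) ((2 : ℝ) • innerSL ℝ (axisOffset c z p)) p := by
  refine (((hasFDerivAt_id p).sub_const c).norm_sq.sub
    (hasFDerivAt_inner_sub_const.pow 2)).congr_fderiv ?_
  ext v
  simp [axisOffset]
  ring

theorem hasFDerivAt_axisOffset :
    HasFDerivAt (axisOffset c z) (ContinuousLinearMap.id ℝ E - (innerSL ℝ z).smulRight z) p :=
  ((hasFDerivAt_id p).sub_const c).sub (hasFDerivAt_inner_sub_const.smul_const z)

variable [CompleteSpace E] {G H : ℝ → ℝ}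

theorem fderiv_fderiv_apply_of_hasGradientAt {F : E → ℝ} {F' : E → E} {F'' : E →L[ℝ] E}
    (hF : ∀ p, HasGradientAt F (F' p) p) (hF' : HasFDerivAt F' F'' p) (v w : E) :
    fderiv ℝ (fderiv ℝ F) p v w = inner ℝ (F'' v) w := by
  have hfderiv : fderiv ℝ F = fun p => innerSL ℝ (F' p) :=
    funext fun p => (hF p).hasFDerivAt.fderiv
  have hcomp : HasFDerivAt (fun p => innerSL ℝ (F' p)) _ p :=
    (innerSL ℝ).hasFDerivAt.comp p hF'
  rw [hfderiv, hcomp.fderiv]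
  rfl

theorem hasGradientAt_revolution (hG : DifferentiableAt ℝ G (axisDistSq c z p))
    (hH : DifferentiableAt ℝ H (inner ℝ z (p - c))) :
    HasGradientAt (fun p => G (axisDistSq c z p) + H (inner ℝ z (p - c)))
      ((2 * deriv G (axisDistSq c z p)) • axisOffset c z p + deriv H (inner ℝ z (p - c)) • z)
      p := by
  refine hasGradientAt_iff_hasFDerivAt.2
    (((hG.hasDerivAt.comp_hasFDerivAt p hasFDerivAt_axisDistSq).add
      (hH.hasDerivAt.comp_hasFDerivAt p hasFDerivAt_inner_sub_const)).congr_fderiv ?_)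
  ext v
  simp
  ring

theorem fderiv_fderiv_revolution (hz : ‖z‖ = 1) (hG : ∀ s, 0 ≤ s → ContDiffAt ℝ 2 G s)
    (hH : ContDiff ℝ 2 H) (v w : E) :
    fderiv ℝ (fderiv ℝ fun p => G (axisDistSq c z p) + H (inner ℝ z (p - c))) p v w =
      2 * deriv G (axisDistSq c z p) * (inner ℝ v w - inner ℝ z v * inner ℝ z w) +
      4 * deriv (deriv G) (axisDistSq c z p) *
        (inner ℝ (axisOffset c z p) v * inner ℝ (axisOffset c z p) w) +
      deriv (deriv H) (inner ℝ z (p - c)) * (inner ℝ z v * inner ℝ z w) := by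
  have hderiv : ∀ {F : ℝ → ℝ} {x : ℝ}, ContDiffAt ℝ 2 F x → DifferentiableAt ℝ (deriv F) x :=
    fun hF => ((hF.fderiv_right (m := 1) (by norm_num)).differentiableAt (by simp)).clm_apply
      (differentiableAt_const 1)
  have hgrad := fun p => hasGradientAt_revolution (c := c) (p := p)
    ((hG _ (axisDistSq_nonneg hz)).differentiableAt (by simp))
    (hH.contDiffAt.differentiableAt (by simp))
  have hG' := ((hderiv (hG _ (axisDistSq_nonneg hz))).hasDerivAt.comp_hasFDerivAt p
    (hasFDerivAt_axisDistSq (c := c) (z := z))).const_mul (2 : ℝ)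
  have hH' := (hderiv hH.contDiffAt).hasDerivAt.comp_hasFDerivAt p
    (hasFDerivAt_inner_sub_const (c := c) (z := z))
  rw [fderiv_fderiv_apply_of_hasGradientAt hgrad
    ((hG'.smul hasFDerivAt_axisOffset).add (hH'.smul_const z))]
  simp [inner_add_left, inner_sub_left, real_inner_smul_left]
  ring

end Revolution

section Frame

variable {E : Type*} [NormedAddCommGroup E] [InnerProductSpace ℝ E] {n : ℕ}

theorem exists_orthonormalBasis_first_last (hn : 0 < n) (hE : Module.finrank ℝ E = n + 1)
    {u v : E} (hu : ‖u‖ = 1) (hv : ‖v‖ = 1) (huv : inner ℝ u v = 0) :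
    ∃ b : OrthonormalBasis (Fin (n + 1)) ℝ E, b 0 = u ∧ b (Fin.last n) = v := by
  have : FiniteDimensional ℝ E := .of_finrank_pos (hE ▸ n.succ_pos)
  have hlast : Fin.last n ≠ 0 := Fin.ne_of_gt hn
  have horth : Orthonormal ℝ (({0, Fin.last n} : Set (Fin (n + 1))).domRestrict
      fun i => if i = 0 then u else v) := by
    rw [orthonormal_iff_ite]
    rintro ⟨i, rfl | rfl⟩ ⟨j, rfl | rfl⟩ <;>
      simp [hlast, hlast.symm, hu, hv, huv, real_inner_comm, Subtype.ext_iff]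
  obtain ⟨b, hb⟩ := horth.exists_orthonormalBasis_extension_of_card_eq (by simpa using hE)
  exact ⟨b, by simpa using hb 0 (by simp), by simpa [hlast] using hb (Fin.last n) (by simp)⟩

theorem exists_norm_eq_one_inner_eq_zero (hE : 1 < Module.finrank ℝ E) {z x : E}
    (hzx : inner ℝ z x = 0) : ∃ u : E, ‖u‖ = 1 ∧ inner ℝ z u = 0 ∧ x = ‖x‖ • u := by
  rcases eq_or_ne x 0 with rfl | hx
  · have : FiniteDimensional ℝ E := .of_finrank_pos (one_pos.trans hE)
    have hperp : 0 < Module.finrank ℝ (ℝ ∙ z)ᗮ := by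
      have := (ℝ ∙ z).finrank_add_finrank_orthogonal
      have : Module.finrank ℝ (ℝ ∙ z) ≤ 1 := by simpa using finrank_span_le_card (R := ℝ) {z}
      omega
    have := Module.nontrivial_of_finrank_pos hperp
    obtain ⟨⟨v, hv⟩, hv0⟩ := exists_ne (0 : (ℝ ∙ z)ᗮ)
    have hv0 : v ≠ 0 := fun h => hv0 (Subtype.ext h)
    refine ⟨‖v‖⁻¹ • v, norm_smul_inv_norm hv0, ?_, by simp⟩
    rw [real_inner_smul_right, Submodule.mem_orthogonal_singleton_iff_inner_right.1 hv, mul_zero]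
  · exact ⟨‖x‖⁻¹ • x, norm_smul_inv_norm hx, by rw [real_inner_smul_right, hzx, mul_zero],
      (smul_inv_smul₀ (norm_ne_zero_iff.2 hx) x).symm⟩

theorem exists_orthonormal_inner_eq_axisVec (hn : 0 < n) (hE : Module.finrank ℝ E = n + 1)
    {z x : E} (hz : ‖z‖ = 1) (hzx : inner ℝ z x = 0) {α β : ℝ} (hαβ : α ^ 2 + β ^ 2 = 1) :
    ∃ e : Fin n → E, Orthonormal ℝ e ∧ (∀ i, inner ℝ z (e i) = axisVec β 0 i) ∧
      ∀ i, inner ℝ x (e i) = axisVec (α * ‖x‖) 0 i := by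
  obtain ⟨u, hu, hzu, hxu⟩ := exists_norm_eq_one_inner_eq_zero (by omega) hzx
  have huz : inner ℝ u z = 0 := real_inner_comm u z ▸ hzu
  have hnorm : ∀ {a b : ℝ}, a ^ 2 + b ^ 2 = 1 → ‖a • u + b • z‖ = 1 := fun {a b} hab => by
    refine (sq_eq_sq₀ (norm_nonneg _) zero_le_one).1 ?_
    rw [norm_add_sq_real, real_inner_smul_left, real_inner_smul_right, huz, norm_smul, norm_smul,
      hu, hz, mul_pow, mul_pow, Real.norm_eq_abs, Real.norm_eq_abs, sq_abs, sq_abs]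
    linarith
  -- Rotating `(u, z)` in its plane gives the meridian direction and the normal.
  obtain ⟨b, hb₀, hbn⟩ := exists_orthonormalBasis_first_last hn hE (u := α • u + β • z)
    (v := -β • u + α • z) (hnorm hαβ) (hnorm (by rw [← hαβ]; ring)) (by
      simp only [inner_add_left, inner_add_right, real_inner_smul_left, real_inner_smul_right,
        real_inner_self_eq_norm_sq, hu, hz, hzu, huz]
      ring)
  have hfirst : ∀ i : Fin n, inner ℝ (b 0) (b i.castSucc) = axisVec 1 0 i := fun i => by
    rw [b.inner_eq_ite]
    exact if_congr (by simp [Fin.ext_iff, eq_comm]) rfl rfl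
  have hlast : ∀ i : Fin n, inner ℝ (b (Fin.last n)) (b i.castSucc) = 0 := fun i => by
    rw [b.inner_eq_ite, if_neg i.castSucc_ne_last.symm]
  have hcoord : ∀ a c : ℝ, ∀ i : Fin n,
      inner ℝ (a • b 0 + c • b (Fin.last n)) (b i.castSucc) = axisVec a 0 i := fun a c i => by
    rw [inner_add_left, real_inner_smul_left, real_inner_smul_left, hfirst, hlast, axisVec,
      axisVec]
    split_ifs <;> ring
  have hz_eq : z = β • b 0 + α • b (Fin.last n) := by
    rw [hb₀, hbn]
    linear_combination (norm := module) -hαβ • z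
  have hu_eq : u = α • b 0 + -β • b (Fin.last n) := by
    rw [hb₀, hbn]
    linear_combination (norm := module) -hαβ • u
  refine ⟨fun i => b i.castSucc, b.orthonormal.comp _ (Fin.castSucc_injective n),
    fun i => ?_, fun i => ?_⟩
  · conv_lhs => rw [hz_eq]
    exact hcoord β α i
  · conv_lhs => rw [hxu, hu_eq, smul_add, smul_smul, smul_smul]
    rw [hcoord, mul_comm]

end Frame

/-- The length of the gradient of `g(s) + h(y)`, where `s` is the squared distance from an axis and
`y` the height along it, in terms of `s` and the first derivatives of `g` and `h`. -/
noncomputable def gradNorm (s g₁ h₁ : ℝ) : ℝ := √(4 * s * g₁ ^ 2 + h₁ ^ 2)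

/-- The principal curvature of a level set of `g(s) + h(y)` in the direction of the meridians, in
terms of `s` and the derivatives of `g` and `h`. -/
noncomputable def meridianCurvature (s g₁ g₂ h₁ h₂ : ℝ) : ℝ :=
  ((2 * g₁ + 4 * s * g₂) * h₁ ^ 2 + 4 * s * g₁ ^ 2 * h₂) / gradNorm s g₁ h₁ ^ 3

/-- The principal curvature of a level set of `g(s) + h(y)` in the directions orthogonal to the
meridians, in terms of `s` and the first derivatives of `g` and `h`. -/
noncomputable def parallelCurvature (s g₁ h₁ : ℝ) : ℝ := 2 * g₁ / gradNorm s g₁ h₁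

theorem gradNorm_nonneg (s g₁ h₁ : ℝ) : 0 ≤ gradNorm s g₁ h₁ := Real.sqrt_nonneg _

theorem gradNorm_sq {s : ℝ} (hs : 0 ≤ s) (g₁ h₁ : ℝ) :
    gradNorm s g₁ h₁ ^ 2 = 4 * s * g₁ ^ 2 + h₁ ^ 2 :=
  Real.sq_sqrt (by positivity)

theorem gradNorm_pos_of_parallelCurvature_pos {s g₁ h₁ : ℝ} (h : 0 < parallelCurvature s g₁ h₁) :
    0 < gradNorm s g₁ h₁ :=
  (gradNorm_nonneg _ _ _).lt_of_ne' (div_ne_zero_iff.1 h.ne').2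

theorem axisVec_mul_axisVec {n : ℕ} (x x' : ℝ) (i j : Fin n) :
    axisVec x 0 i * axisVec x' 0 j = if i = j then axisVec (x * x') 0 i else 0 := by
  unfold axisVec
  split_ifs with hi hj hij hij
  all_goals simp_all [Fin.ext_iff]

section Revolution

variable {E : Type*} [NormedAddCommGroup E] [InnerProductSpace ℝ E] {c z p : E} {n : ℕ}

theorem norm_gradient_revolution (hz : ‖z‖ = 1) (g₁ h₁ : ℝ) :
    ‖(2 * g₁) • axisOffset c z p + h₁ • z‖ = gradNorm (axisDistSq c z p) g₁ h₁ := by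
  refine (sq_eq_sq₀ (norm_nonneg _) (gradNorm_nonneg _ _ _)).1 ?_
  rw [gradNorm_sq (axisDistSq_nonneg hz), norm_add_sq_real, real_inner_smul_left,
    real_inner_smul_right, real_inner_comm, inner_axisOffset hz, norm_smul, norm_smul, mul_pow,
    mul_pow, norm_axisOffset_sq hz, hz, Real.norm_eq_abs, Real.norm_eq_abs, sq_abs, sq_abs]
  ring

theorem exists_principal_frame_revolution (hn : 0 < n) (hE : Module.finrank ℝ E = n + 1)
    (hz : ‖z‖ = 1) {g₁ h₁ : ℝ} (hN : gradNorm (axisDistSq c z p) g₁ h₁ ≠ 0) (g₂ h₂ : ℝ) :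
    ∃ e : Fin n → E, Orthonormal ℝ e ∧
      (∀ i, inner ℝ ((2 * g₁) • axisOffset c z p + h₁ • z) (e i) = 0) ∧
      ∀ i j, 2 * g₁ * (inner ℝ (e i) (e j) - inner ℝ z (e i) * inner ℝ z (e j)) +
          4 * g₂ * (inner ℝ (axisOffset c z p) (e i) * inner ℝ (axisOffset c z p) (e j)) +
          h₂ * (inner ℝ z (e i) * inner ℝ z (e j)) =
        if i = j then axisVec (meridianCurvature (axisDistSq c z p) g₁ g₂ h₁ h₂)
          (parallelCurvature (axisDistSq c z p) g₁ h₁) i *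
            gradNorm (axisDistSq c z p) g₁ h₁ else 0 := by
  have hs : ‖axisOffset c z p‖ ^ 2 = axisDistSq c z p := norm_axisOffset_sq hz
  have hN2 := gradNorm_sq (axisDistSq_nonneg (c := c) (p := p) hz) g₁ h₁
  unfold meridianCurvature parallelCurvature
  generalize axisDistSq c z p = s, gradNorm (axisDistSq c z p) g₁ h₁ = N,
    hx : axisOffset c z p = x at *
  have hzx : inner ℝ z x = 0 := hx ▸ inner_axisOffset hz
  have hαβ : (h₁ / N) ^ 2 + (-(2 * g₁ * ‖x‖) / N) ^ 2 = 1 := by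
    rw [div_pow, div_pow, ← add_div, div_eq_one_iff_eq (pow_ne_zero 2 hN), hN2, ← hs]
    ring
  obtain ⟨e, he, hze, hxe⟩ := exists_orthonormal_inner_eq_axisVec hn hE hz hzx hαβ
  refine ⟨e, he, fun i => ?_, fun i j => ?_⟩
  · rw [inner_add_left, real_inner_smul_left, real_inner_smul_left, hze, hxe]
    unfold axisVec
    split_ifs <;> ring
  · rw [orthonormal_iff_ite.1 he, hze, hze, hxe, hxe, axisVec_mul_axisVec, axisVec_mul_axisVec]
    split_ifs with hij
    · unfold axisVec
      split_ifs
      · have hβ : 1 - -(2 * g₁ * ‖x‖) / N * (-(2 * g₁ * ‖x‖) / N) = (h₁ / N) ^ 2 := by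
          rw [← hαβ]
          ring
        rw [hβ, ← hs]
        field_simp
        ring
      · field_simp
        ring
    · ring

/-- The function `g(s, t) + h(y)` on space-time, where `s` is the squared distance from the axis
through `c` in the direction of `z` and `y` the height along that axis. Its sublevel sets are the
evolving bodies of revolution used as barriers. -/
noncomputable def revolution (c z : E) (g : ℝ → ℝ → ℝ) (h : ℝ → ℝ) (q : E × ℝ) : ℝ :=
  g (axisDistSq c z q.1) q.2 + h (inner ℝ z (q.1 - c))

theorem contDiff_revolution {k : WithTop ℕ∞} (hz : ‖z‖ = 1) {g : ℝ → ℝ → ℝ} {h : ℝ → ℝ}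
    (hg : ∀ s, 0 ≤ s → ∀ τ, ContDiffAt ℝ k ↿g (s, τ)) (hh : ContDiff ℝ k h) :
    ContDiff ℝ k (revolution c z g h) := by
  refine contDiff_iff_contDiffAt.2 fun q => ContDiffAt.add ?_ ?_
  · exact (hg _ (axisDistSq_nonneg hz) q.2).comp q
      ((contDiff_axisDistSq.comp contDiff_fst).prodMk contDiff_snd).contDiffAt
  · exact (hh.comp (contDiff_const.inner ℝ (contDiff_fst.sub contDiff_const))).contDiffAt

end Revolution

section Evolution

variable {n : ℕ} {a b t : ℝ} {c z p : Space n}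

theorem HasBoundaryData.notMem_interior {Ω : ℝ → Set (Space n)} {κ : Fin n → ℝ} {V : ℝ}
    (h : HasBoundaryData Ω a b p t κ V) (ht : t ∈ Icc a b) : p ∉ interior (Ω t) := by
  intro hp
  obtain ⟨φ, U, hU, hpU, -, hΩ, h0, hgrad, -⟩ := h
  have hmax : IsLocalMax (fun x => φ (x, t)) p := by
    filter_upwards [(Continuous.prodMk_left t).continuousAt.eventually (hU.mem_nhds hpU),
      mem_interior_iff_mem_nhds.1 hp] with x hx hx'
    exact h0 ▸ (hΩ (x, t) hx ht).1 hx'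
  exact hgrad (by rw [gradient, hmax.fderiv_eq_zero, map_zero])

theorem isSmoothEvolution_sublevel {rel : ℝ → (Fin n → ℝ) → Prop} {φ : Space n × ℝ → ℝ}
    (hφ : Continuous φ)
    (hbd : ∀ t ∈ Icc a b, ∀ p, φ (p, t) = 0 → ∃ (κ : Fin n → ℝ) (V : ℝ),
      HasBoundaryData (fun t => {p | φ (p, t) ≤ 0}) a b p t κ V ∧ κ ∈ posCone n ∧ rel V κ) :
    IsSmoothEvolution rel (fun t => {p | φ (p, t) ≤ 0}) a b where
  closed t _ := isClosed_le (hφ.comp (Continuous.prodMk_left t)) continuous_const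
  inside t ht p hp := by
    have hle : φ (p, t) ≤ 0 := (interior_subset hp :)
    rcases hle.lt_or_eq with hlt | h0
    · filter_upwards [hφ.continuousAt.eventually_lt_const hlt] with q hq _ using hq.le
    · obtain ⟨κ, V, hdata, -⟩ := hbd t ht p h0
      exact absurd hp (hdata.notMem_interior ht)
  outside t _ p hp := by
    filter_upwards [hφ.continuousAt.eventually_const_lt (not_le.1 hp)] with q hq _
      using not_le.2 hq
  boundary t ht p hp :=
    hbd t ht p (frontier_le_subset_eq (hφ.comp (Continuous.prodMk_left t)) continuous_const hp)

variable {g : ℝ → ℝ → ℝ} {h : ℝ → ℝ}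

theorem hasBoundaryData_revolution (hn : 0 < n) (hz : ‖z‖ = 1)
    (hg : ∀ s, 0 ≤ s → ∀ τ, ContDiffAt ℝ ∞ ↿g (s, τ)) (hh : ContDiff ℝ ∞ h)
    (hp : revolution c z g h (p, t) = 0) {s y : ℝ} (hs : axisDistSq c z p = s)
    (hy : inner ℝ z (p - c) = y) (hN : gradNorm s (deriv (g · t) s) (deriv h y) ≠ 0) :
    HasBoundaryData (fun τ => {q | revolution c z g h (q, τ) ≤ 0}) a b p t
      (axisVec
        (meridianCurvature s (deriv (g · t) s) (deriv (deriv (g · t)) s) (deriv h y)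
          (deriv (deriv h) y))
        (parallelCurvature s (deriv (g · t) s) (deriv h y)))
      (deriv (g s) t / gradNorm s (deriv (g · t) s) (deriv h y)) := by
  have hgt : ∀ s, 0 ≤ s → ContDiffAt ℝ ∞ (g · t) s := fun s hs =>
    (hg s hs t).comp s (contDiff_prodMk_left t).contDiffAt
  have hgrad : gradient (fun q => revolution c z g h (q, t)) p =
      (2 * deriv (g · t) s) • axisOffset c z p + deriv h y • z := by
    subst hs hy
    exact (hasGradientAt_revolution ((hgt _ (axisDistSq_nonneg hz)).differentiableAt (by simp))
      (hh.differentiable (by simp) _)).gradient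
  have hHess := fderiv_fderiv_revolution (c := c) (p := p) (G := (g · t)) hz
    (fun s hs => (hgt s hs).of_le (WithTop.coe_le_coe.2 le_top))
    (hh.of_le (WithTop.coe_le_coe.2 le_top))
  rw [hs, hy] at hHess
  have hnorm : ‖gradient (fun q => revolution c z g h (q, t)) p‖ =
      gradNorm s (deriv (g · t) s) (deriv h y) := by
    rw [hgrad, norm_gradient_revolution hz, hs]
  obtain ⟨e, he, hperp, hdiag⟩ := exists_principal_frame_revolution (c := c) (p := p)
    (g₁ := deriv (g · t) s) (h₁ := deriv h y) hn (by simp) hz (by rwa [hs])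
    (deriv (deriv (g · t)) s) (deriv (deriv h) y)
  rw [hs] at hdiag
  refine ⟨revolution c z g h, univ, isOpen_univ, mem_univ _,
    (contDiff_revolution hz hg hh).contDiffOn, fun q _ _ => Iff.rfl, hp,
    norm_ne_zero_iff.1 (hnorm ▸ hN), ⟨e, he, fun i => hgrad ▸ hperp i, fun i j => ?_⟩, ?_⟩
  · rw [hnorm, ← hdiag i j, ← hHess]
    rfl
  · rw [hnorm]
    simp [revolution, hs]

theorem isSmoothEvolution_revolution (hn : 0 < n) {rel : ℝ → (Fin n → ℝ) → Prop} (hz : ‖z‖ = 1)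
    (hg : ∀ s, 0 ≤ s → ∀ τ, ContDiffAt ℝ ∞ ↿g (s, τ)) (hh : ContDiff ℝ ∞ h)
    (hrel : ∀ t ∈ Icc a b, ∀ s y, 0 ≤ s → g s t + h y = 0 →
      0 < meridianCurvature s (deriv (g · t) s) (deriv (deriv (g · t)) s) (deriv h y)
        (deriv (deriv h) y) ∧
      0 < parallelCurvature s (deriv (g · t) s) (deriv h y) ∧
      rel (deriv (g s) t / gradNorm s (deriv (g · t) s) (deriv h y))
        (axisVec
          (meridianCurvature s (deriv (g · t) s) (deriv (deriv (g · t)) s) (deriv h y)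
            (deriv (deriv h) y))
          (parallelCurvature s (deriv (g · t) s) (deriv h y)))) :
    IsSmoothEvolution rel (fun t => {p : Space n | revolution c z g h (p, t) ≤ 0}) a b := by
  refine isSmoothEvolution_sublevel (contDiff_revolution hz hg hh).continuous
    fun t ht p hp => ?_
  obtain ⟨hm, hpar, hV⟩ := hrel t ht _ _ (axisDistSq_nonneg hz) hp
  exact ⟨_, _, hasBoundaryData_revolution hn hz hg hh hp rfl rfl
    (gradNorm_pos_of_parallelCurvature_pos hpar).ne', axisVec_mem_posCone hm hpar, hV⟩

end Evolution

section Quadrics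

variable {n : ℕ} {f : (Fin n → ℝ) → ℝ} {a b : ℝ} {c z : Space n}

theorem isSmoothEvolution_quadric (hn : 0 < n) {rel : ℝ → (Fin n → ℝ) → Prop} (hz : ‖z‖ = 1)
    {m β ρ : ℝ} (hm : 0 < m) (hρ : ∀ t ∈ Icc a b, β * (t - a) < ρ)
    (hrel : ∀ s y N, 0 < N → N ^ 2 = 4 * (s + m ^ 2 * y ^ 2) → 0 < s + m * y ^ 2 →
      rel (β / N) (axisVec (8 * m * (s + m * y ^ 2) / N ^ 3) (2 / N))) :
    IsSmoothEvolution rel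
      (fun t => {p | axisDistSq c z p + m * inner ℝ z (p - c) ^ 2 ≤ ρ - β * (t - a)}) a b := by
  have hset : (fun t => {p | axisDistSq c z p + m * inner ℝ z (p - c) ^ 2 ≤ ρ - β * (t - a)}) =
      fun t => {p | revolution c z (fun s t => s + β * (t - a)) (fun y => m * y ^ 2 - ρ) (p, t) ≤
        0} := by
    ext t p
    simp only [mem_ofPred_eq, revolution]
    constructor <;> intro h <;> linarith
  rw [hset]
  refine isSmoothEvolution_revolution hn hz (fun s _ τ => ?_) (by fun_prop) fun t ht s y hs h0 => ?_
  · exact ContDiff.contDiffAt (by fun_prop)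
  have hpos : 0 < s + m * y ^ 2 := by linarith [hρ t ht]
  have hg₁ : deriv (fun s => s + β * (t - a)) = fun _ => 1 := by
    ext; simp
  have hg₂ : deriv (fun t => s + β * (t - a)) t = β := by simp
  have hh₁ : deriv (fun y => m * y ^ 2 - ρ) = fun y => 2 * m * y := by
    ext y; simp; ring
  have hh₂ : deriv (fun y => 2 * m * y) y = 2 * m := by simp
  have hmer : meridianCurvature s 1 0 (2 * m * y) (2 * m) =
      8 * m * (s + m * y ^ 2) / gradNorm s 1 (2 * m * y) ^ 3 := by
    rw [meridianCurvature]; ring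
  have hpar : parallelCurvature s 1 (2 * m * y) = 2 / gradNorm s 1 (2 * m * y) := by
    rw [parallelCurvature, mul_one]
  have hN2 : gradNorm s 1 (2 * m * y) ^ 2 = 4 * (s + m ^ 2 * y ^ 2) := by
    rw [gradNorm_sq hs]; ring
  have hN : 0 < gradNorm s 1 (2 * m * y) := by
    refine (gradNorm_nonneg _ _ _).lt_of_ne' fun h => ?_
    rw [h] at hN2
    nlinarith [sq_nonneg (m * y), mul_pos hm hm]
  simp only [hg₁, hg₂, hh₁, hh₂, deriv_const, hmer, hpar]
  exact ⟨by positivity, by positivity, hrel s y _ hN hN2 hpos⟩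

theorem isSupersolution_closedBall (hf : IsSpeed f) {β ρ : ℝ} (hβ : β ≤ 2)
    (hρ : ∀ t ∈ Icc a b, β * (t - a) < ρ) :
    IsSupersolution f (fun t => {p | ‖p - c‖ ^ 2 ≤ ρ - β * (t - a)}) a b := by
  obtain ⟨z, hz⟩ := exists_norm_eq (Space n) zero_le_one
  have hset : (fun t => {p | ‖p - c‖ ^ 2 ≤ ρ - β * (t - a)}) =
      fun t => {p | axisDistSq c z p + 1 * inner ℝ z (p - c) ^ 2 ≤ ρ - β * (t - a)} := by
    simp [axisDistSq]
  rw [hset]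
  refine isSmoothEvolution_quadric hf.dim_pos hz one_pos hρ fun s y N hN hN2 _ => ?_
  have hκ : 8 * 1 * (s + 1 * y ^ 2) / N ^ 3 = 2 / N := by
    rw [div_eq_div_iff (by positivity) hN.ne']
    linear_combination (-2 * N) * hN2
  rw [hκ, hf.apply_axisVec_self (by positivity)]
  gcongr

theorem isSubsolution_ellipsoid (hf : IsSpeed f) {K : ℝ} (hK : ∀ x, 0 < x → fhat f x ≤ K)
    (hz : ‖z‖ = 1) {m ρ : ℝ} (hm : 0 < m) (hρ : ∀ t ∈ Icc a b, 2 * K * (t - a) < ρ) :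
    IsSubsolution f (fun t => {p | axisDistSq c z p + m * inner ℝ z (p - c) ^ 2 ≤
      ρ - 2 * K * (t - a)}) a b := by
  refine isSmoothEvolution_quadric hf.dim_pos hz hm hρ fun s y N hN _ hpos => ?_
  have hκ : 0 < 8 * m * (s + m * y ^ 2) / N ^ 3 :=
    div_pos (mul_pos (by positivity) hpos) (by positivity)
  rw [hf.apply_axisVec hκ (by positivity), mul_div_right_comm 2 K N]
  exact mul_le_mul_of_nonneg_left (hK _ (by positivity)) (by positivity)

end Quadrics

section InnerBarrier

variable {n : ℕ} {f : (Fin n → ℝ) → ℝ} {A : ℝ → Set (Space n)} {I : Set ℝ} {a t : ℝ}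
  {c z : Space n}

theorem IsInnerBarrier.norm_sub_sq_le (hf : IsSpeed f) (hA : IsInnerBarrier f A I) (hat : a ≤ t)
    (hI : Icc a t ⊆ I) {β ρ : ℝ} (hβ : 0 ≤ β) (hβ' : β ≤ 2) (hρ : β * (t - a) < ρ)
    (h0 : ∀ p ∈ A a, ‖p - c‖ ^ 2 ≤ ρ) : ∀ p ∈ A t, ‖p - c‖ ^ 2 ≤ ρ - β * (t - a) := by
  rcases hat.eq_or_lt with rfl | hat
  · simpa using h0
  have h0' : A a ⊆ {p | ‖p - c‖ ^ 2 ≤ ρ - β * (a - a)} := by simpa [subset_def] using h0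
  refine hA a t hat hI _ (isSupersolution_closedBall hf hβ' fun τ hτ => ?_) h0' t
    ⟨hat.le, le_rfl⟩
  exact (mul_le_mul_of_nonneg_left (sub_le_sub_right hτ.2 a) hβ).trans_lt hρ

theorem IsInnerBarrier.subset_closedBall (hf : IsSpeed f) (hA : IsInnerBarrier f A I) (hat : a ≤ t)
    (hI : Icc a t ⊆ I) {R : ℝ} (hR : 0 < R) (h0 : A a ⊆ Metric.closedBall c R) :
    A t ⊆ Metric.closedBall c R := by
  have hball : ∀ p, p ∈ Metric.closedBall c R ↔ ‖p - c‖ ^ 2 ≤ R ^ 2 := fun p => by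
    rw [mem_closedBall_iff_norm, sq_le_sq₀ (norm_nonneg _) hR.le]
  intro p hp
  have hp' := hA.norm_sub_sq_le hf hat hI le_rfl zero_le_two
    (by simpa using pow_pos hR 2) (fun q hq => (hball q).1 (h0 hq)) p hp
  rwa [zero_mul, sub_zero, ← hball] at hp'

theorem exists_closedBall_superset_notMem {E : Type*} [NormedAddCommGroup E]
    [InnerProductSpace ℝ E] {K : Set E} (hK : Bornology.IsBounded K) {z p : E} {d : ℝ}
    (hz : ‖z‖ = 1) (hKd : ∀ q ∈ K, inner ℝ q z ≤ d) (hp : d < inner ℝ p z) :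
    ∃ c r, 0 < r ∧ K ⊆ Metric.closedBall c r ∧ p ∉ Metric.closedBall c r := by
  obtain ⟨ϱ, hϱ⟩ := hK.subset_closedBall p
  set δ := inner ℝ p z - d
  have hδ : 0 < δ := sub_pos.2 hp
  have hr : 0 < ϱ ^ 2 / δ + δ / 2 := by positivity
  refine ⟨p - (ϱ ^ 2 / δ + δ) • z, ϱ ^ 2 / δ + δ / 2, hr, fun q hq => ?_, fun hmem => ?_⟩
  · have hqp : ‖q - p‖ ^ 2 ≤ ϱ ^ 2 :=
      pow_le_pow_left₀ (norm_nonneg _) (mem_closedBall_iff_norm.1 (hϱ hq)) 2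
    have hqz : inner ℝ (q - p) z ≤ -δ := by
      rw [inner_sub_left]
      linarith [hKd q hq]
    rw [mem_closedBall_iff_norm, ← sq_le_sq₀ (norm_nonneg _) hr.le, sub_sub_eq_add_sub,
      add_sub_right_comm, norm_add_sq_real, real_inner_smul_right, norm_smul, mul_pow, hz,
      Real.norm_eq_abs, sq_abs]
    have hδϱ : ϱ ^ 2 / δ * δ = ϱ ^ 2 := div_mul_cancel₀ _ hδ.ne'
    nlinarith [mul_le_mul_of_nonneg_left hqz (by positivity : 0 ≤ ϱ ^ 2 / δ + δ)]
  · rw [mem_closedBall_iff_norm, sub_sub_cancel, norm_smul, hz, mul_one,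
      Real.norm_of_nonneg (by positivity)] at hmem
    linarith

theorem IsInnerBarrier.inner_le (hf : IsSpeed f) (hA : IsInnerBarrier f A I) (hat : a ≤ t)
    (hI : Icc a t ⊆ I) (hb : Bornology.IsBounded (A a)) (hz : ‖z‖ = 1) {d : ℝ}
    (h0 : ∀ p ∈ A a, inner ℝ p z ≤ d) : ∀ p ∈ A t, inner ℝ p z ≤ d := by
  intro p hp
  by_contra! hlt
  obtain ⟨c, r, hr, hsub, hpr⟩ := exists_closedBall_superset_notMem hb hz h0 hlt
  exact hpr (hA.subset_closedBall hf hat hI hr hsub hp)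

-- Two shrinking spheres, centred at distance `d` from `c` on opposite sides, both enclose the
-- small ball; where they both still contain `p`, the parallelogram law bounds the elapsed time.
theorem IsInnerBarrier.two_mul_sub_le_of_subset_closedBall (hf : IsSpeed f)
    (hA : IsInnerBarrier f A I) (hat : a ≤ t) (hI : Icc a t ⊆ I) (hne : (A t).Nonempty) {ε d : ℝ}
    (hε : 0 < ε) (hd : 0 ≤ d) (htd : 2 * (t - a) ≤ d ^ 2) (h0 : A a ⊆ Metric.closedBall c ε) :
    2 * (t - a) ≤ ε ^ 2 + 2 * ε * d := by
  obtain ⟨p, hp⟩ := hne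
  obtain ⟨v, hv⟩ := exists_norm_eq (Space n) hd
  have hle : ∀ w : Space n, ‖w‖ = d → ‖p - c - w‖ ^ 2 ≤ (ε + d) ^ 2 - 2 * (t - a) := by
    intro w hw
    rw [sub_sub]
    refine hA.norm_sub_sq_le hf hat hI zero_le_two le_rfl (by nlinarith) (fun q hq => ?_) p hp
    rw [← sub_sub]
    refine pow_le_pow_left₀ (norm_nonneg _) ((norm_sub_le _ _).trans ?_) 2
    exact add_le_add (mem_closedBall_iff_norm.1 (h0 hq)) hw.le
  have hsum := parallelogram_law_with_norm ℝ (p - c) v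
  have h₁ := hle v hv
  have h₂ := hle (-v) (by rwa [norm_neg])
  rw [sub_neg_eq_add] at h₂
  rw [hv] at hsum
  nlinarith [sq_nonneg ‖p - c‖]

theorem IsInnerBarrier.two_mul_sub_le_sq (hf : IsSpeed f) (hA : IsInnerBarrier f A I) (hat : a ≤ t)
    (hI : Icc a t ⊆ I) (hne : (A t).Nonempty) {R : ℝ} (hR : 0 < R)
    (h0 : A a ⊆ Metric.closedBall c R) : 2 * (t - a) ≤ R ^ 2 := by
  by_contra! hlt
  set d := 1 + (t - a)
  have hd : 0 < d := by linarith
  obtain ⟨ε, hε, hεmin⟩ : ∃ ε, 0 < ε ∧ ε < min R ((2 * (t - a) - R ^ 2) / (2 * d)) :=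
    exists_between (lt_min hR (div_pos (sub_pos.2 hlt) (by positivity)))
  obtain ⟨hεR, hεd⟩ := lt_min_iff.1 hεmin
  rw [lt_div_iff₀ (by positivity)] at hεd
  set τ := a + (R ^ 2 - ε ^ 2) / 2 with hτ
  have haτ : a ≤ τ := by nlinarith
  have hτt : τ ≤ t := by nlinarith
  have hsub : A τ ⊆ Metric.closedBall c ε := fun p hp => by
    refine mem_closedBall_iff_norm.2 ((sq_le_sq₀ (norm_nonneg _) hε.le).1 ?_)
    refine (hA.norm_sub_sq_le hf haτ ((Icc_subset_Icc_right hτt).trans hI) zero_le_two le_rfl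
      (ρ := R ^ 2) (by nlinarith) (fun q hq => ?_) p hp).trans (by linarith)
    exact pow_le_pow_left₀ (norm_nonneg _) (mem_closedBall_iff_norm.1 (h0 hq)) 2
  have hext := hA.two_mul_sub_le_of_subset_closedBall hf hτt
    ((Icc_subset_Icc_left haτ).trans hI) hne hε hd.le (by nlinarith) hsub
  linarith

end InnerBarrier

section FlatSidesStay

theorem ellipsoid_subset_halfBall {E : Type*} [NormedAddCommGroup E] [InnerProductSpace ℝ E]
    {y₀ z : E} (hz : ‖z‖ = 1) {r d : ℝ} (hr : 0 < r) (hd : 0 < d) (hdr : d < r / 4) :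
    {p | axisDistSq (y₀ - (2 * d) • z) z p +
        r ^ 2 / (4 * d ^ 2) * inner ℝ z (p - (y₀ - (2 * d) • z)) ^ 2 ≤ r ^ 2 / 4} ⊆
      Metric.ball y₀ r ∩ {p | inner ℝ p z < inner ℝ y₀ z} := by
  intro p hp
  have hs : 0 ≤ axisDistSq (y₀ - (2 * d) • z) z p := axisDistSq_nonneg hz
  have hnorm : ‖p - y₀‖ ^ 2 = axisDistSq (y₀ - (2 * d) • z) z p +
      (inner ℝ z (p - (y₀ - (2 * d) • z)) - 2 * d) ^ 2 := by
    rw [axisDistSq, sub_sub_eq_add_sub, add_sub_right_comm, norm_add_sq_real, inner_add_right,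
      real_inner_smul_right, real_inner_smul_right, real_inner_self_eq_norm_sq, norm_smul, hz,
      mul_one, Real.norm_eq_abs, sq_abs, real_inner_comm]
    ring
  have hinner : inner ℝ p z - inner ℝ y₀ z = inner ℝ z (p - (y₀ - (2 * d) • z)) - 2 * d := by
    rw [sub_sub_eq_add_sub, add_sub_right_comm, inner_add_right, real_inner_smul_right,
      real_inner_self_eq_norm_sq, hz, inner_sub_right, real_inner_comm z, real_inner_comm z]
    ring
  rw [mem_ofPred_eq] at hp
  generalize axisDistSq (y₀ - (2 * d) • z) z p = s,
    inner ℝ z (p - (y₀ - (2 * d) • z)) = y at hp hs hnorm hinner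
  have hy : y ^ 2 ≤ d ^ 2 := by
    have hmy : r ^ 2 / (4 * d ^ 2) * y ^ 2 ≤ r ^ 2 / (4 * d ^ 2) * d ^ 2 := by
      rw [show r ^ 2 / (4 * d ^ 2) * d ^ 2 = r ^ 2 / 4 by field_simp]
      linarith
    exact le_of_mul_le_mul_left hmy (by positivity)
  have hsr : s ≤ r ^ 2 / 4 := le_of_add_le_of_nonneg_left hp (by positivity)
  obtain ⟨hy₁, hy₂⟩ := abs_le_of_sq_le_sq' hy hd.le
  refine ⟨mem_ball_iff_norm.2 (lt_of_pow_lt_pow_left₀ 2 hr.le ?_),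
    sub_neg.1 (hinner.trans_lt (by linarith))⟩
  rw [hnorm]
  nlinarith

theorem notMem_interior_of_inner_le {E : Type*} [NormedAddCommGroup E] [InnerProductSpace ℝ E]
    {K : Set E} {z y₀ : E} (hz : z ≠ 0) (hK : ∀ p ∈ K, inner ℝ p z ≤ inner ℝ y₀ z) :
    y₀ ∉ interior K := by
  intro hint
  have hmax : IsLocalMax (innerSL ℝ z) y₀ := by
    filter_upwards [mem_interior_iff_mem_nhds.1 hint] with p hp
    simpa only [innerSL_apply_apply, real_inner_comm] using hK p hp
  have hzero := hmax.hasFDerivAt_eq_zero (innerSL ℝ z).hasFDerivAt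
  exact hz (inner_self_eq_zero.1 (DFunLike.congr_fun hzero z))

variable {n : ℕ} {f : (Fin n → ℝ) → ℝ} {A : ℝ → Set (Space n)} {I : Set ℝ} {a t : ℝ}
  {y₀ z : Space n}

theorem IsOuterBarrier.mem_closure (hf : IsSpeed f) {K : ℝ} (hK : ∀ x, 0 < x → fhat f x ≤ K)
    (hA : IsOuterBarrier f A I) (hat : a < t) (hI : Icc a t ⊆ I) (hz : ‖z‖ = 1) {r : ℝ}
    (hr : 0 < r) (hball : Metric.ball y₀ r ∩ {p | inner ℝ p z < inner ℝ y₀ z} ⊆ A a)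
    (htr : 8 * K * (t - a) < r ^ 2) : y₀ ∈ closure (A t) := by
  have hK0 : 0 < K := (hf.fhat_pos one_pos).trans_le (hK 1 one_pos)
  have hmem : ∀ d ∈ Ioo 0 (r / 4), y₀ - (2 * d) • z ∈ A t := fun d hd => by
    have hρ : ∀ τ ∈ Icc a t, 2 * K * (τ - a) < r ^ 2 / 4 := fun τ hτ => by
      have := mul_le_mul_of_nonneg_left (sub_le_sub_right hτ.2 a) hK0.le
      linarith
    refine hA a t hat hI _ (isSubsolution_ellipsoid (c := y₀ - (2 * d) • z) hf hK
      hz (div_pos (pow_pos hr 2) (mul_pos four_pos (pow_pos hd.1 2))) hρ) ?_ t ⟨hat.le, le_rfl⟩ ?_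
    · simpa only [sub_self, mul_zero, sub_zero] using
        (ellipsoid_subset_halfBall hz hr hd.1 hd.2).trans hball
    · simpa [axisDistSq] using (hρ t ⟨hat.le, le_rfl⟩).le
  have hlim : Tendsto (fun d : ℝ => y₀ - (2 * d) • z) (𝓝[>] 0) (𝓝 y₀) := by
    have hcont : Continuous fun d : ℝ => y₀ - (2 * d) • z := by fun_prop
    simpa using (hcont.tendsto 0).mono_left nhdsWithin_le_nhds
  refine mem_closure_of_tendsto hlim ?_
  filter_upwards [Ioo_mem_nhdsGT (by positivity : (0 : ℝ) < r / 4)] with d hd using hmem d hd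

theorem IsBarrierSolution.mem_frontier (hf : IsSpeed f) {K : ℝ} (hK : ∀ x, 0 < x → fhat f x ≤ K)
    (hA : IsBarrierSolution f A I) (hat : a < t) (hI : Icc a t ⊆ I)
    (hb : Bornology.IsBounded (A a)) (hz : ‖z‖ = 1) {r : ℝ} (hr : 0 < r)
    (hle : ∀ p ∈ A a, inner ℝ p z ≤ inner ℝ y₀ z)
    (hball : Metric.ball y₀ r ∩ {p | inner ℝ p z < inner ℝ y₀ z} ⊆ A a)
    (htr : 8 * K * (t - a) < r ^ 2) : y₀ ∈ frontier (A t) :=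
  ⟨hA.1.mem_closure hf hK hat hI hz hr hball htr,
    notMem_interior_of_inner_le (norm_ne_zero_iff.1 (hz ▸ one_ne_zero))
      (hA.2.inner_le hf hat.le hI hb hz hle)⟩

end FlatSidesStay

section StrictJet

/-- Strict inequalities on a `2`-jet `(u, p, q)` at `s ≥ 0` of a function of the squared distance
`s` from the axis. Here `F` stands for `fhat f χ`. For `0 < m ≤ M` they make a graph with the
`2`-jet `(m u, m p, m q)` and the downward velocity `μ m u` a strict supersolution that is strictly
convex, has slope less than `1 / 2` and principal curvatures of ratio less than `χ`. -/
structure IsStrictJet (χ F μ M s u p q : ℝ) : Prop where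
  pos : 0 < p
  convex : 0 < 2 * p + 4 * s * q
  ratio_lt : 2 * p + 4 * s * q < χ * (2 * p)
  slope_lt : 4 * s * (M * p) ^ 2 < 1 / 4
  speed_lt : μ * u * (5 / 4) * χ < F * (2 * p + 4 * s * q)

theorem isOpen_setOf_isStrictJet (χ F μ M : ℝ) :
    IsOpen {x : ℝ × ℝ × ℝ × ℝ | IsStrictJet χ F μ M x.1 x.2.1 x.2.2.1 x.2.2.2} := by
  have hiff : ∀ s u p q : ℝ, IsStrictJet χ F μ M s u p q ↔ 0 < p ∧ 0 < 2 * p + 4 * s * q ∧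
      2 * p + 4 * s * q < χ * (2 * p) ∧ 4 * s * (M * p) ^ 2 < 1 / 4 ∧
      μ * u * (5 / 4) * χ < F * (2 * p + 4 * s * q) := fun s u p q =>
    ⟨fun h => ⟨h.1, h.2, h.3, h.4, h.5⟩, fun ⟨h₁, h₂, h₃, h₄, h₅⟩ => ⟨h₁, h₂, h₃, h₄, h₅⟩⟩
  simp only [hiff]
  refine IsOpen.and ?_ (IsOpen.and ?_ (IsOpen.and ?_ (IsOpen.and ?_ ?_))) <;>
    exact isOpen_lt (by fun_prop) (by fun_prop)

theorem meridianCurvature_graph_pos {m p q s : ℝ} (hm : 0 < m) (hs : 0 ≤ s)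
    (hpq : 0 < 2 * p + 4 * s * q) : 0 < meridianCurvature s (m * p) (m * q) 1 0 := by
  have hN : 0 < gradNorm s (m * p) 1 := Real.sqrt_pos.2 (by positivity)
  rw [meridianCurvature]
  refine div_pos ?_ (pow_pos hN 3)
  linear_combination m * hpq

theorem parallelCurvature_graph_pos {m p s : ℝ} (hm : 0 < m) (hs : 0 ≤ s) (hp : 0 < p) :
    0 < parallelCurvature s (m * p) 1 :=
  div_pos (by positivity) (Real.sqrt_pos.2 (by positivity))

theorem IsStrictJet.div_gradNorm_le {n : ℕ} {f : (Fin n → ℝ) → ℝ} (hf : IsSpeed f)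
    {χ μ M s u p q m V : ℝ} (h : IsStrictJet χ (fhat f χ) μ M s u p q) (hχ : 0 < χ) (hs : 0 ≤ s)
    (hμu : 0 ≤ μ * u) (hm : 0 < m) (hmM : m ≤ M) (hV : V ≤ m * (μ * u)) :
    V / gradNorm s (m * p) 1 ≤ f (axisVec (meridianCurvature s (m * p) (m * q) 1 0)
      (parallelCurvature s (m * p) 1)) := by
  obtain ⟨hp, hQ, hratio, hslope, hspeed⟩ := h
  have hmer := meridianCurvature_graph_pos hm hs hQ
  have hN : 0 < gradNorm s (m * p) 1 := Real.sqrt_pos.2 (by positivity)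
  have hN2 : gradNorm s (m * p) 1 ^ 2 = 4 * s * (m * p) ^ 2 + 1 := by
    rw [gradNorm_sq hs, one_pow]
  have hmer_eq : meridianCurvature s (m * p) (m * q) 1 0 =
      m * (2 * p + 4 * s * q) / gradNorm s (m * p) 1 ^ 3 := by
    rw [meridianCurvature]; ring
  set N := gradNorm s (m * p) 1
  set Q := 2 * p + 4 * s * q
  have hN_ge : 1 ≤ N ^ 2 := by rw [hN2]; linarith [show 0 ≤ 4 * s * (m * p) ^ 2 by positivity]
  have hN_le : N ^ 2 ≤ 5 / 4 := by
    have : 4 * s * (m * p) ^ 2 ≤ 4 * s * (M * p) ^ 2 := by gcongr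
    linarith
  have hle : meridianCurvature s (m * p) (m * q) 1 0 ≤ χ * parallelCurvature s (m * p) 1 := by
    rw [hmer_eq, parallelCurvature, div_le_iff₀ (by positivity)]
    calc m * Q ≤ m * (χ * (2 * p)) * 1 := by rw [mul_one]; gcongr
      _ ≤ m * (χ * (2 * p)) * N ^ 2 := by gcongr
      _ = χ * (2 * (m * p) / N) * N ^ 3 := by field_simp
  have hspeed_le : μ * u * (N ^ 2 * χ) ≤ fhat f χ * Q := by
    calc μ * u * (N ^ 2 * χ) ≤ μ * u * (5 / 4 * χ) := by gcongr
      _ ≤ fhat f χ * Q := by linarith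
  refine le_trans ?_ (hf.mul_fhat_div_le_apply_axisVec hmer hχ hle)
  calc V / N ≤ m * (μ * u) / N := by gcongr
    _ = m * (μ * u * (N ^ 2 * χ)) / (N ^ 3 * χ) := by field_simp
    _ ≤ m * (fhat f χ * Q) / (N ^ 3 * χ) :=
        div_le_div_of_nonneg_right (mul_le_mul_of_nonneg_left hspeed_le hm.le) (by positivity)
    _ = meridianCurvature s (m * p) (m * q) 1 0 * fhat f χ / χ := by
        rw [hmer_eq]; field_simp

end StrictJet

section MovingGraph

/-- A positive function `w` of the squared distance `s ≥ 0` from the axis whose graph is smooth and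
strictly convex: the last condition says that `r ↦ w (r ^ 2)` has a positive second derivative. -/
structure IsConvexProfile (w : ℝ → ℝ) : Prop where
  contDiffAt : ∀ s, 0 ≤ s → ContDiffAt ℝ ∞ w s
  pos : ∀ s, 0 ≤ s → 0 < w s
  deriv_pos : ∀ s, 0 ≤ s → 0 < deriv w s
  convex : ∀ s, 0 ≤ s → 0 < 2 * deriv w s + 4 * s * deriv (deriv w) s

theorem contDiffAt_deriv {u : ℝ → ℝ} {s : ℝ} {k l : WithTop ℕ∞} (hu : ContDiffAt ℝ l u s)
    (hkl : k + 1 ≤ l) : ContDiffAt ℝ k (deriv u) s :=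
  (hu.fderiv_right hkl).clm_apply contDiffAt_const

theorem deriv_affine_comb {w v : ℝ → ℝ} {s : ℝ} (hw : DifferentiableAt ℝ w s)
    (hv : DifferentiableAt ℝ v s) (m ε k : ℝ) :
    deriv (fun s => m * (w s + ε * v s) - k) s = m * (deriv w s + ε * deriv v s) :=
  (((hw.hasDerivAt.add (hv.hasDerivAt.const_mul ε)).const_mul m).sub_const k).deriv

theorem deriv_deriv_affine_comb {w v : ℝ → ℝ} {s : ℝ} (hw : ContDiffAt ℝ 2 w s)
    (hv : ContDiffAt ℝ 2 v s) (m ε k : ℝ) :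
    deriv (deriv fun s => m * (w s + ε * v s) - k) s =
      m * (deriv (deriv w) s + ε * deriv (deriv v) s) := by
  have heq : deriv (fun s => m * (w s + ε * v s) - k) =ᶠ[𝓝 s]
      fun s => m * (deriv w s + ε * deriv v s) - 0 := by
    filter_upwards [hw.eventually (by simp), hv.eventually (by simp)] with x hwx hvx
    rw [deriv_affine_comb (hwx.differentiableAt two_ne_zero) (hvx.differentiableAt two_ne_zero),
      sub_zero]
  rw [heq.deriv_eq,
    deriv_affine_comb ((contDiffAt_deriv (k := 1) hw le_rfl).differentiableAt one_ne_zero)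
      ((contDiffAt_deriv (k := 1) hv le_rfl).differentiableAt one_ne_zero)]

variable {n : ℕ} {f : (Fin n → ℝ) → ℝ} {c z : Space n} {w v : ℝ → ℝ} {m M χ μ B k t₀ t₁ : ℝ}

theorem isSupersolution_graph (hf : IsSpeed f) (hz : ‖z‖ = 1)
    (hw : IsConvexProfile w) (hv : ∀ s, 0 ≤ s → ContDiffAt ℝ ∞ v s) (hvw : ∀ s, 0 ≤ s → v s ≤ w s)
    (hvB : ∀ s, B ≤ s → v s = 0) (hχ : 0 < χ) (hμ : 0 ≤ μ) (hm : 0 < m) (hmM : m ≤ M)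
    (hjet : ∀ t ∈ Icc t₀ t₁, ∀ s ∈ Icc 0 B, IsStrictJet χ (fhat f χ) μ M s
      (Real.exp (μ * (t - t₀)) * w s)
      (deriv w s + (Real.exp (μ * (t - t₀)) - 1) * deriv v s)
      (deriv (deriv w) s + (Real.exp (μ * (t - t₀)) - 1) * deriv (deriv v) s)) :
    IsSupersolution f (fun t => {p | m * (w (axisDistSq c z p) +
      (Real.exp (μ * (t - t₀)) - 1) * v (axisDistSq c z p)) - k + inner ℝ z (p - c) ≤ 0})
      t₀ t₁ := by
  refine isSmoothEvolution_revolution hf.dim_pos hz (h := fun y => y)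
    (g := fun s t => m * (w s + (Real.exp (μ * (t - t₀)) - 1) * v s) - k)
    (fun s hs τ => ?_) contDiff_id fun t ht s y hs _ => ?_
  · have hw' : ContDiffAt ℝ ∞ (fun q : ℝ × ℝ => w q.1) (s, τ) :=
      (hw.contDiffAt s hs).comp _ contDiffAt_fst
    have hv' : ContDiffAt ℝ ∞ (fun q : ℝ × ℝ => v q.1) (s, τ) := (hv s hs).comp _ contDiffAt_fst
    have hε : ContDiffAt ℝ ∞ (fun q : ℝ × ℝ => Real.exp (μ * (q.2 - t₀)) - 1) (s, τ) := by fun_prop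
    exact (contDiffAt_const.mul (hw'.add (hε.mul hv'))).sub contDiffAt_const
  have htwo : (2 : WithTop ℕ∞) ≤ ∞ := WithTop.coe_le_coe.2 le_top
  have hg₁ := deriv_affine_comb ((hw.contDiffAt s hs).differentiableAt (by simp))
    ((hv s hs).differentiableAt (by simp)) m (Real.exp (μ * (t - t₀)) - 1) k
  have hg₂ := deriv_deriv_affine_comb ((hw.contDiffAt s hs).of_le htwo) ((hv s hs).of_le htwo) m
    (Real.exp (μ * (t - t₀)) - 1) k
  have hgt : deriv (fun t => m * (w s + (Real.exp (μ * (t - t₀)) - 1) * v s) - k) t =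
      m * (μ * (Real.exp (μ * (t - t₀)) * v s)) := by
    have hexp := (((hasDerivAt_id t).sub_const t₀).const_mul μ).exp
    refine ((((hexp.sub_const 1).mul_const (v s)).const_add (w s)).const_mul m
      |>.sub_const k).deriv.trans ?_
    simp only [id]
    ring
  simp only [hg₁, hg₂, hgt, deriv_id'', deriv_const]
  rcases le_or_gt s B with hsB | hsB
  · have hj := hjet t ht s ⟨hs, hsB⟩
    refine ⟨meridianCurvature_graph_pos hm hs hj.convex, parallelCurvature_graph_pos hm hs hj.pos,
      hj.div_gradNorm_le hf hχ hs ?_ hm hmM ?_⟩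
    · exact mul_nonneg hμ (mul_nonneg (Real.exp_pos _).le (hw.pos s hs).le)
    · gcongr
      exact hvw s hs
  · have hv_nhds : v =ᶠ[𝓝 s] fun _ => 0 := by
      filter_upwards [lt_mem_nhds hsB] with x hx using hvB x hx.le
    have hv₁ : deriv v =ᶠ[𝓝 s] fun _ => 0 := by simpa using hv_nhds.deriv
    have hv₂ : deriv (deriv v) s = 0 := by simpa using hv₁.deriv_eq
    rw [hv_nhds.eq_of_nhds, hv₁.eq_of_nhds, hv₂]
    simp only [mul_zero, add_zero, zero_div]
    have hmer := meridianCurvature_graph_pos hm hs (hw.convex s hs)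
    have hpar := parallelCurvature_graph_pos hm hs (hw.deriv_pos s hs)
    exact ⟨hmer, hpar, (hf.pos _ (axisVec_mem_posCone hmer hpar)).le⟩

theorem exists_forall_isStrictJet {F : ℝ} (hw : ∀ s, 0 ≤ s → ContDiffAt ℝ ∞ w s)
    (hv : ∀ s, 0 ≤ s → ContDiffAt ℝ ∞ v s)
    (hjet : ∀ s ∈ Icc 0 B, IsStrictJet χ F μ M s (w s) (deriv w s) (deriv (deriv w) s)) :
    ∃ ε₀ > 0, ∀ ε ∈ Icc 0 ε₀, ∀ s ∈ Icc 0 B, IsStrictJet χ F μ M s ((1 + ε) * w s)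
      (deriv w s + ε * deriv v s) (deriv (deriv w) s + ε * deriv (deriv v) s) := by
  have hev : ∀ᶠ ε in 𝓝 (0 : ℝ), ∀ s ∈ Icc 0 B, IsStrictJet χ F μ M s ((1 + ε) * w s)
      (deriv w s + ε * deriv v s) (deriv (deriv w) s + ε * deriv (deriv v) s) := by
    refine isCompact_Icc.eventually_forall_of_forall_eventually fun s hs => ?_
    have hcont : ∀ {u : ℝ → ℝ}, ContDiffAt ℝ ∞ u s →
        ContinuousAt (fun q : ℝ × ℝ => u q.2) (0, s) := fun hu =>
      hu.continuousAt.comp' (x := ((0 : ℝ), s)) continuousAt_snd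
    have hw₁ := contDiffAt_deriv (k := ∞) (hw s hs.1) le_rfl
    have hv₁ := contDiffAt_deriv (k := ∞) (hv s hs.1) le_rfl
    have hjets : ContinuousAt (fun q : ℝ × ℝ => (q.2, (1 + q.1) * w q.2,
        deriv w q.2 + q.1 * deriv v q.2, deriv (deriv w) q.2 + q.1 * deriv (deriv v) q.2))
        (0, s) := by
      have hw₂ := contDiffAt_deriv (k := ∞) hw₁ le_rfl
      have hv₂ := contDiffAt_deriv (k := ∞) hv₁ le_rfl
      exact continuousAt_snd.prodMk <|
        ((continuousAt_fst.const_add 1).mul (hcont (hw s hs.1))).prodMk <|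
        ((hcont hw₁).add (continuousAt_fst.mul (hcont hv₁))).prodMk <|
        (hcont hw₂).add (continuousAt_fst.mul (hcont hv₂))
    refine hjets.eventually_mem ((isOpen_setOf_isStrictJet χ F μ M).mem_nhds ?_)
    simpa using hjet s hs
  obtain ⟨ε₀, hε₀, hball⟩ := Metric.eventually_nhds_iff_ball.1 hev
  refine ⟨ε₀ / 2, half_pos hε₀, fun ε hε => hball ε ?_⟩
  rw [Metric.mem_ball, Real.dist_eq, sub_zero, abs_of_nonneg hε.1]
  linarith [hε.2]

theorem exists_contDiff_cutoff {A B : ℝ} (hAB : A < B) : ∃ η : ℝ → ℝ, ContDiff ℝ ∞ η ∧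
    (∀ s, η s ≤ 1) ∧ (∀ s ≤ A, η s = 1) ∧ ∀ s, B ≤ s → η s = 0 := by
  have hBA : 0 < B - A := sub_pos.2 hAB
  refine ⟨fun s => Real.smoothTransition ((B - s) / (B - A)),
    Real.smoothTransition.contDiff.comp ((contDiff_const.sub contDiff_id).div_const _),
    fun s => Real.smoothTransition.le_one _,
    fun s hs => Real.smoothTransition.one_of_one_le ?_,
    fun s hs => Real.smoothTransition.zero_of_nonpos ?_⟩
  · rw [one_le_div hBA]
    linarith
  · exact div_nonpos_of_nonpos_of_nonneg (by linarith) hBA.le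

theorem of_forall_small_step {P : ℝ → Prop} {a b δ : ℝ} (hab : a ≤ b) (hδ : 0 < δ) (ha : P a)
    (hstep : ∀ s t, a ≤ s → s < t → t ≤ b → t - s ≤ δ → P s → P t) : P b := by
  have hind : ∀ (j : ℕ) (t : ℝ), a ≤ t → t ≤ b → t - a ≤ j * δ → P t := by
    intro j
    induction j with
    | zero =>
      intro t hat _ ht
      rwa [le_antisymm (by simpa using ht) hat]
    | succ j ih =>
      intro t hat htb ht
      rcases hat.eq_or_lt with rfl | hat
      · exact ha
      push_cast at ht
      refine hstep (max a (t - δ)) t (le_max_left _ _) (max_lt hat (by linarith)) htb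
        (by linarith [le_max_right a (t - δ)])
        (ih _ (le_max_left _ _) (max_le hab (by linarith)) ?_)
      rw [sub_le_iff_le_add]
      exact max_le (le_add_of_nonneg_left (by positivity)) (by linarith)
  obtain ⟨j, hj⟩ := exists_nat_ge ((b - a) / δ)
  exact hind j b hab le_rfl ((div_le_iff₀ hδ).1 hj)

theorem IsInnerBarrier.graph_le {A : ℝ → Set (Space n)} {I : Set ℝ} {a t B₁ : ℝ} (hf : IsSpeed f)
    (hA : IsInnerBarrier f A I) (hat : a ≤ t) (hI : Icc a t ⊆ I) (hz : ‖z‖ = 1)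
    (hw : IsConvexProfile w) (hχ : 0 < χ) (hμ : 0 < μ) (hm : 0 < m) (hB : B₁ < B)
    (hcyl : ∀ τ ∈ Icc a t, ∀ p ∈ A τ, axisDistSq c z p ≤ B₁)
    (hjet : ∀ s ∈ Icc 0 B, IsStrictJet χ (fhat f χ) μ (m * Real.exp (μ * (t - a))) s (w s)
      (deriv w s) (deriv (deriv w) s))
    (h0 : ∀ p ∈ A a, m * w (axisDistSq c z p) - k + inner ℝ z (p - c) ≤ 0) :
    ∀ p ∈ A t,
      m * Real.exp (μ * (t - a)) * w (axisDistSq c z p) - k + inner ℝ z (p - c) ≤ 0 := by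
  -- The graph moves only where `η ≠ 0`, hence over the cylinder that contains the sets `A τ`; over
  -- short time steps the cutoff perturbs the jets too little to spoil the strict inequalities.
  obtain ⟨η, hη, hη_le, hη_one, hη_zero⟩ := exists_contDiff_cutoff hB
  have hv : ∀ s, 0 ≤ s → ContDiffAt ℝ ∞ (fun s => η s * w s) s := fun s hs =>
    hη.contDiffAt.mul (hw.contDiffAt s hs)
  obtain ⟨ε, hε, hpert⟩ := exists_forall_isStrictJet hw.contDiffAt hv hjet
  have hδ : 0 < Real.log (1 + ε) / μ := div_pos (Real.log_pos (by linarith)) hμ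
  refine of_forall_small_step (P := fun τ => ∀ p ∈ A τ,
    m * Real.exp (μ * (τ - a)) * w (axisDistSq c z p) - k + inner ℝ z (p - c) ≤ 0) hat hδ
    (by simpa using h0) fun t₀ t₁ ha h01 h1t hδt hin p hp => ?_
  have hexp_mem : ∀ τ ∈ Icc t₀ t₁, Real.exp (μ * (τ - t₀)) - 1 ∈ Icc 0 ε := fun τ hτ => by
    have hle : μ * (τ - t₀) ≤ Real.log (1 + ε) := by
      rw [mul_comm, ← le_div_iff₀ hμ]
      linarith [hτ.2]
    refine ⟨sub_nonneg.2 (Real.one_le_exp (mul_nonneg hμ.le (sub_nonneg.2 hτ.1))), ?_⟩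
    linarith [(Real.le_log_iff_exp_le (by linarith)).1 hle]
  have hM : m * Real.exp (μ * (t₀ - a)) ≤ m * Real.exp (μ * (t - a)) := by
    gcongr
    linarith
  have hsup := isSupersolution_graph (c := c) (k := k) (t₀ := t₀) (t₁ := t₁) hf hz hw hv
    (fun s hs => mul_le_of_le_one_left (hw.pos s hs).le (hη_le s))
    (fun s hs => by rw [hη_zero s hs, zero_mul]) hχ hμ.le
    (mul_pos hm (Real.exp_pos (μ * (t₀ - a)))) hM fun τ hτ s hs => by
      simpa only [add_sub_cancel] using hpert _ (hexp_mem τ hτ) s hs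
  have hmem := hA t₀ t₁ h01 ((Icc_subset_Icc ha h1t).trans hI) _ hsup
    (fun q hq => by simpa using hin q hq) t₁ ⟨h01.le, le_rfl⟩ hp
  rw [mem_ofPred_eq, hη_one _ (hcyl t₁ ⟨ha.trans h01.le, h1t⟩ p hp), one_mul, ← one_add_mul,
    add_sub_cancel, ← mul_assoc, mul_assoc m, ← Real.exp_add] at hmem
  rwa [show μ * (t₁ - a) = μ * (t₀ - a) + μ * (t₁ - t₀) by ring]

end MovingGraph

section Profile

/-- The profile `exp √(1 + l² s)` as a function of the squared distance `s` from the axis: the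
exponential growth `exp (l r)` of the graph in the radius `r = √s`, smoothed at the axis. -/
noncomputable def profile (l s : ℝ) : ℝ := Real.exp √(1 + l ^ 2 * s)

variable {l s : ℝ}

theorem profile_pos (l s : ℝ) : 0 < profile l s := Real.exp_pos _

theorem one_le_sqrt_one_add (l : ℝ) (hs : 0 ≤ s) : 1 ≤ √(1 + l ^ 2 * s) :=
  Real.one_le_sqrt.2 (le_add_of_nonneg_right (by positivity))

theorem contDiffAt_profile (h : 0 < 1 + l ^ 2 * s) : ContDiffAt ℝ ∞ (profile l) s :=
  ((contDiffAt_const.add (contDiffAt_const.mul contDiffAt_id)).sqrt h.ne').exp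

theorem hasDerivAt_sqrt_one_add (h : 0 < 1 + l ^ 2 * s) :
    HasDerivAt (fun s => √(1 + l ^ 2 * s)) (l ^ 2 / (2 * √(1 + l ^ 2 * s))) s := by
  have hlin : HasDerivAt (fun s => 1 + l ^ 2 * s) (l ^ 2) s := by
    simpa using ((hasDerivAt_id s).const_mul (l ^ 2)).const_add 1
  exact hlin.sqrt h.ne'

theorem hasDerivAt_profile (h : 0 < 1 + l ^ 2 * s) :
    HasDerivAt (profile l) (profile l s * (l ^ 2 / (2 * √(1 + l ^ 2 * s)))) s :=
  (hasDerivAt_sqrt_one_add h).exp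

theorem deriv_profile (h : 0 < 1 + l ^ 2 * s) :
    deriv (profile l) s = profile l s * (l ^ 2 / (2 * √(1 + l ^ 2 * s))) :=
  (hasDerivAt_profile h).deriv

theorem deriv_deriv_profile (h : 0 < 1 + l ^ 2 * s) :
    deriv (deriv (profile l)) s =
      profile l s * (l ^ 4 / 4 * (1 / √(1 + l ^ 2 * s) ^ 2 - 1 / √(1 + l ^ 2 * s) ^ 3)) := by
  have heq : deriv (profile l) =ᶠ[𝓝 s] fun s => profile l s * (l ^ 2 / (2 * √(1 + l ^ 2 * s))) := by
    have hcont : Continuous fun s => 1 + l ^ 2 * s := by fun_prop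
    filter_upwards [hcont.continuousAt.eventually_const_lt h] with x hx using deriv_profile hx
  have : 0 < √(1 + l ^ 2 * s) := Real.sqrt_pos.2 h
  refine heq.deriv_eq.trans (((hasDerivAt_profile h).mul ((hasDerivAt_const s (l ^ 2)).div
    ((hasDerivAt_sqrt_one_add h).const_mul 2) (by positivity))).deriv.trans ?_)
  simp only [Pi.div_apply]
  field_simp
  ring

theorem radial_deriv_profile (l : ℝ) (hs : 0 ≤ s) :
    2 * deriv (profile l) s + 4 * s * deriv (deriv (profile l)) s =
      profile l s * l ^ 2 * (1 - (√(1 + l ^ 2 * s))⁻¹ ^ 2 + (√(1 + l ^ 2 * s))⁻¹ ^ 3) := by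
  have hpos : 0 < 1 + l ^ 2 * s := by positivity
  have hv : 0 < √(1 + l ^ 2 * s) := Real.sqrt_pos.2 hpos
  have hls : l ^ 4 * s = l ^ 2 * (√(1 + l ^ 2 * s) ^ 2 - 1) := by
    rw [Real.sq_sqrt hpos.le]; ring
  rw [deriv_profile hpos, deriv_deriv_profile hpos]
  generalize √(1 + l ^ 2 * s) = v at hv hls
  calc _ = profile l s * (l ^ 2 / v + l ^ 4 * s * (1 / v ^ 2 - 1 / v ^ 3)) := by field_simp
    _ = _ := by
        rw [hls]
        field_simp
        ring

theorem le_one_sub_sq_add_cube {x : ℝ} (hx : 0 ≤ x) : 23 / 27 ≤ 1 - x ^ 2 + x ^ 3 := by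
  linarith [show 0 ≤ (x - 2 / 3) ^ 2 * (x + 1 / 3) by positivity]

theorem le_radial_deriv_profile (l : ℝ) (hs : 0 ≤ s) : profile l s * l ^ 2 * (23 / 27) ≤
    2 * deriv (profile l) s + 4 * s * deriv (deriv (profile l)) s := by
  rw [radial_deriv_profile l hs]
  exact mul_le_mul_of_nonneg_left (le_one_sub_sq_add_cube (inv_nonneg.2 (Real.sqrt_nonneg _)))
    (mul_nonneg (profile_pos l s).le (sq_nonneg l))

theorem isConvexProfile_profile (hl : l ≠ 0) : IsConvexProfile (profile l) where
  contDiffAt s hs := contDiffAt_profile (by positivity)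
  pos s _ := profile_pos l s
  deriv_pos s hs := by
    rw [deriv_profile (by positivity)]
    have := profile_pos l s
    have := one_le_sqrt_one_add l hs
    positivity
  convex s hs := by
    refine lt_of_lt_of_le ?_ (le_radial_deriv_profile l hs)
    have := profile_pos l s
    positivity

end Profile

section FlatSidesMove

theorem isStrictJet_profile {χ F μ M V l s : ℝ} (hl : 0 < l) (hs : 0 ≤ s) (hF : 0 ≤ F) (hM : 0 ≤ M)
    (hV : √(1 + l ^ 2 * s) ≤ V) (hVχ : V < χ) (hMV : M * Real.exp V * l ≤ 1 / 2)
    (hμ : μ * (5 / 4) * χ < F * (l ^ 2 * (23 / 27))) :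
    IsStrictJet χ F μ M s (profile l s) (deriv (profile l) s) (deriv (deriv (profile l)) s) := by
  have hprof := isConvexProfile_profile hl.ne'
  have hw : 0 < profile l s := profile_pos l s
  have hwV : profile l s ≤ Real.exp V := Real.exp_le_exp.2 hV
  have hv : 1 ≤ √(1 + l ^ 2 * s) := one_le_sqrt_one_add l hs
  have hpos : 0 < 1 + l ^ 2 * s := by positivity
  have hv2 : √(1 + l ^ 2 * s) ^ 2 = 1 + l ^ 2 * s := Real.sq_sqrt hpos.le
  refine ⟨hprof.deriv_pos s hs, hprof.convex s hs, ?_, ?_, ?_⟩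
  · rw [radial_deriv_profile l hs, deriv_profile hpos]
    generalize √(1 + l ^ 2 * s) = v at hV hv
    have hcube : v⁻¹ ^ 3 ≤ v⁻¹ ^ 2 :=
      pow_le_pow_of_le_one (by positivity) (inv_le_one_of_one_le₀ hv) (by norm_num)
    calc profile l s * l ^ 2 * (1 - v⁻¹ ^ 2 + v⁻¹ ^ 3) ≤ profile l s * l ^ 2 * 1 := by
          gcongr; linarith
      _ < profile l s * l ^ 2 * (χ / v) := by
          gcongr
          rw [one_lt_div (by positivity)]
          linarith
      _ = χ * (2 * (profile l s * (l ^ 2 / (2 * v)))) := by field_simp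
  · rw [deriv_profile hpos]
    generalize √(1 + l ^ 2 * s) = v at hv hv2
    calc 4 * s * (M * (profile l s * (l ^ 2 / (2 * v)))) ^ 2
        = (M * profile l s * l) ^ 2 * (l ^ 2 * s / v ^ 2) := by field_simp; ring
      _ ≤ (M * Real.exp V * l) ^ 2 * (l ^ 2 * s / v ^ 2) := by gcongr
      _ ≤ (1 / 2) ^ 2 * (l ^ 2 * s / v ^ 2) := by gcongr
      _ < (1 / 2) ^ 2 * 1 := by
          gcongr
          rw [div_lt_one (by positivity), hv2]
          linarith
      _ = 1 / 4 := by norm_num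
  · calc μ * profile l s * (5 / 4) * χ = profile l s * (μ * (5 / 4) * χ) := by ring
      _ < profile l s * (F * (l ^ 2 * (23 / 27))) := by gcongr
      _ = F * (profile l s * l ^ 2 * (23 / 27)) := by ring
      _ ≤ _ := mul_le_mul_of_nonneg_left (le_radial_deriv_profile l hs) hF

theorem sqrt_one_add_le {χ R s : ℝ} (hχ : 5 ≤ χ) (hR : 0 < R)
    (hs : s ≤ (R * (1 + 1 / (10 * χ))) ^ 2) :
    √(1 + (χ / (2 * R)) ^ 2 * s) ≤ χ / 2 + 1 / 4 := by
  have hbound : (χ / (2 * R)) ^ 2 * s ≤ (χ / 2 + 1 / 20) ^ 2 := by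
    calc (χ / (2 * R)) ^ 2 * s ≤ (χ / (2 * R)) ^ 2 * (R * (1 + 1 / (10 * χ))) ^ 2 := by gcongr
      _ = (χ / 2 + 1 / 20) ^ 2 := by
          have : 0 < χ := by linarith
          field_simp
          ring
  exact Real.sqrt_le_iff.2 ⟨by positivity, by nlinarith⟩

theorem isStrictJet_profile_of_le {χ R T s : ℝ} (hT : 0 < T) (hR : 0 < R) (hχ : 5 ≤ χ)
    (hs : 0 ≤ s) (hsB : s ≤ (R * (1 + 1 / (10 * χ))) ^ 2) :
    IsStrictJet χ (3 * R ^ 2 / T) (χ / (2 * T)) (R * Real.exp (-(χ / 2 + 1 / 4)) / χ) s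
      (profile (χ / (2 * R)) s) (deriv (profile (χ / (2 * R))) s)
      (deriv (deriv (profile (χ / (2 * R)))) s) := by
  have : 0 < χ := by linarith
  refine isStrictJet_profile (by positivity) hs (by positivity) (by positivity)
    (sqrt_one_add_le hχ hR hsB) (by linarith) (le_of_eq ?_) ?_
  · rw [Real.exp_neg]
    field_simp
  · calc χ / (2 * T) * (5 / 4) * χ = χ ^ 2 / T * (5 / 8) := by field_simp; ring
      _ < χ ^ 2 / T * (3 / 4 * (23 / 27)) := by gcongr; norm_num
      _ = 3 * R ^ 2 / T * ((χ / (2 * R)) ^ 2 * (23 / 27)) := by field_simp; ring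

theorem three_rpow_neg_le {x : ℝ} (hx : 0 < x) : (3 : ℝ) ^ (-x) ≤ Real.exp (-(x / 2)) / x := by
  have hexp : Real.exp x ≤ 3 ^ x := by
    rw [← Real.exp_one_rpow]
    exact Real.rpow_le_rpow (Real.exp_pos _).le Real.exp_one_lt_three.le hx.le
  have hx_le : x ≤ Real.exp (x / 2) := by
    have := Real.quadratic_le_exp_of_nonneg (half_pos hx).le
    nlinarith [sq_nonneg (x / 2 - 1)]
  rw [Real.rpow_neg zero_le_three, le_div_iff₀ hx]
  calc (3 ^ x)⁻¹ * x ≤ (Real.exp x)⁻¹ * Real.exp (x / 2) := by gcongr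
    _ = Real.exp (-(x / 2)) := by rw [← Real.exp_neg, ← Real.exp_add]; congr 1; ring

theorem two_mul_exp_quarter_le : 2 * Real.exp (1 / 4) ≤ Real.exp 1 := by
  have htwo : 2 ≤ Real.exp (3 / 4) := by
    rw [← Real.log_le_iff_le_exp two_pos]
    linarith [Real.log_two_lt_d9]
  calc 2 * Real.exp (1 / 4) ≤ Real.exp (3 / 4) * Real.exp (1 / 4) := by gcongr
    _ = Real.exp 1 := by rw [← Real.exp_add]; norm_num

theorem mul_three_rpow_neg_le {R χ : ℝ} (hR : 0 ≤ R) (hχ : 0 < χ) :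
    R * 3 ^ (-χ) ≤
      R * Real.exp (-(χ / 2 + 1 / 4)) / χ * (Real.exp 1 - Real.exp (1 / 4)) := by
  calc R * 3 ^ (-χ) ≤ R * (Real.exp (-(χ / 2)) / χ) := by gcongr; exact three_rpow_neg_le hχ
    _ = R * Real.exp (-(χ / 2 + 1 / 4)) / χ * Real.exp (1 / 4) := by
        rw [show -(χ / 2) = -(χ / 2 + 1 / 4) + 1 / 4 by ring, Real.exp_add]
        ring
    _ ≤ R * Real.exp (-(χ / 2 + 1 / 4)) / χ * (Real.exp 1 - Real.exp (1 / 4)) := by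
        gcongr
        linarith [two_mul_exp_quarter_le]

variable {n : ℕ} {f : (Fin n → ℝ) → ℝ} {A : ℝ → Set (Space n)} {I : Set ℝ} {a t : ℝ}
  {c z : Space n}

theorem IsInnerBarrier.inner_le_sub_three_rpow (hf : IsSpeed f) (hA : IsInnerBarrier f A I)
    (hat : a < t) (hI : Icc a t ⊆ I) (hz : ‖z‖ = 1) {R χ d : ℝ} (hR : 0 < R) (hχ : 5 ≤ χ)
    (hfχ : fhat f χ = 3 * R ^ 2 / (t - a))
    (hcyl : ∀ τ ∈ Icc a t, ∀ p ∈ A τ, axisDistSq c z p ≤ (R * (1 + 1 / (20 * χ))) ^ 2)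
    (h0 : ∀ p ∈ A a, inner ℝ p z ≤ d) : ∀ p ∈ A t, inner ℝ p z ≤ d - R * 3 ^ (-χ) := by
  have hχ₀ : 0 < χ := by linarith
  have hT : 0 < t - a := sub_pos.2 hat
  set l := χ / (2 * R)
  set M := R * Real.exp (-(χ / 2 + 1 / 4)) / χ
  have hl₀ : 0 < l := by positivity
  have : 0 < M := by positivity
  have hB_lt : (R * (1 + 1 / (20 * χ))) ^ 2 < (R * (1 + 1 / (10 * χ))) ^ 2 := by
    gcongr; norm_num
  have hgrow : M * Real.exp (-(χ / 2)) * Real.exp (χ / (2 * (t - a)) * (t - a)) = M := by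
    have : χ / (2 * (t - a)) * (t - a) = χ / 2 := by field_simp
    rw [this, mul_assoc, ← Real.exp_add, neg_add_cancel, Real.exp_zero, mul_one]
  have hstart : ∀ p ∈ A a, M * Real.exp (-(χ / 2)) * profile l (axisDistSq c z p) ≤
      M * Real.exp (1 / 4) := fun p hp => by
    have hs := (hcyl a ⟨le_rfl, hat.le⟩ p hp).trans hB_lt.le
    calc M * Real.exp (-(χ / 2)) * profile l (axisDistSq c z p)
        ≤ M * Real.exp (-(χ / 2)) * Real.exp (χ / 2 + 1 / 4) := by
          gcongr
          exact Real.exp_le_exp.2 (sqrt_one_add_le hχ hR hs)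
      _ = M * Real.exp (1 / 4) := by
          rw [mul_assoc, ← Real.exp_add, neg_add_cancel_left]
  have hgraph := hA.graph_le (w := profile l) (μ := χ / (2 * (t - a)))
    (m := M * Real.exp (-(χ / 2))) (k := M * Real.exp (1 / 4) + (d - inner ℝ z c)) (c := c)
    hf hat.le hI hz (isConvexProfile_profile hl₀.ne') hχ₀ (by positivity) (by positivity)
    hB_lt hcyl (fun s hs => ?_) (fun p hp => ?_)
  · intro p hp
    have hp' := hgraph p hp
    rw [hgrow, inner_sub_right, real_inner_comm p z] at hp'
    have hw : M * Real.exp 1 ≤ M * profile l (axisDistSq c z p) := by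
      gcongr
      exact Real.exp_le_exp.2 (one_le_sqrt_one_add l (axisDistSq_nonneg hz))
    have hdescent : R * 3 ^ (-χ) ≤ M * (Real.exp 1 - Real.exp (1 / 4)) :=
      mul_three_rpow_neg_le hR.le hχ₀
    linarith
  · rw [hgrow, hfχ]
    exact isStrictJet_profile_of_le hT hR hχ hs.1 hs.2
  · rw [inner_sub_right, real_inner_comm p z]
    linarith [h0 p hp, hstart p hp]

end FlatSidesMove

section SupportFunction

variable {n : ℕ} {K : Set (Space n)}

theorem circumradius_nonneg (K : Set (Space n)) : 0 ≤ circumradius K :=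
  Real.sInf_nonneg fun _ hR => hR.1

theorem exists_subset_closedBall {R : ℝ} (hb : Bornology.IsBounded K) (hR : circumradius K < R) :
    ∃ c, K ⊆ Metric.closedBall c R := by
  obtain ⟨R₀, hR₀, hR₀K⟩ := hb.subset_closedBall_lt 0 0
  obtain ⟨R', ⟨-, c, hc⟩, hR'⟩ := exists_lt_of_csInf_lt
    (s := {R : ℝ | 0 ≤ R ∧ ∃ c : Space n, K ⊆ Metric.closedBall c R}) ⟨R₀, hR₀.le, 0, hR₀K⟩ hR
  exact ⟨c, hc.trans (Metric.closedBall_subset_closedBall hR'.le)⟩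

theorem inner_le_supportFn (hb : Bornology.IsBounded K) (z : Space n) {p : Space n} (hp : p ∈ K) :
    inner ℝ p z ≤ supportFn K z := by
  obtain ⟨R, hR⟩ := hb.exists_norm_le
  refine le_csSup ⟨R * ‖z‖, ?_⟩ (mem_image_of_mem _ hp)
  rintro _ ⟨q, hq, rfl⟩
  exact (real_inner_le_norm q z).trans (by gcongr; exact hR q hq)

end SupportFunction

namespace IsInnerBarrier

variable {n : ℕ} {f : (Fin n → ℝ) → ℝ} {A : ℝ → Set (Space n)} {I : Set ℝ} {a t : ℝ}

theorem isBounded (hf : IsSpeed f) (hA : IsInnerBarrier f A I) (hat : a ≤ t) (hI : Icc a t ⊆ I)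
    (hb : Bornology.IsBounded (A a)) : Bornology.IsBounded (A t) := by
  obtain ⟨R, hR, h0⟩ := hb.subset_closedBall_lt 0 0
  exact Metric.isBounded_closedBall.subset (hA.subset_closedBall hf hat hI hR h0)

theorem two_mul_sub_le_circumradius_sq (hf : IsSpeed f) (hA : IsInnerBarrier f A I) (hat : a ≤ t)
    (hI : Icc a t ⊆ I) (hb : Bornology.IsBounded (A a)) (hne : (A t).Nonempty) :
    2 * (t - a) ≤ circumradius (A a) ^ 2 := by
  refine le_of_forall_gt_imp_ge_of_dense fun x hx => ?_
  have hx₀ : 0 < x := (sq_nonneg _).trans_lt hx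
  obtain ⟨c, hc⟩ := exists_subset_closedBall hb ((Real.lt_sqrt (circumradius_nonneg _)).2 hx)
  exact (hA.two_mul_sub_le_sq hf hat hI hne (Real.sqrt_pos.2 hx₀) hc).trans_eq
    (Real.sq_sqrt hx₀.le)

theorem circumradius_pos (hf : IsSpeed f) (hA : IsInnerBarrier f A I) (hat : a < t)
    (hI : Icc a t ⊆ I) (hb : Bornology.IsBounded (A a)) (hne : (A t).Nonempty) :
    0 < circumradius (A a) := by
  refine (circumradius_nonneg _).lt_of_ne' fun h0 => ?_
  have := hA.two_mul_sub_le_circumradius_sq hf hat.le hI hb hne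
  rw [h0] at this
  linarith

theorem six_le_three_mul_circumradius_sq_div (hf : IsSpeed f) (hA : IsInnerBarrier f A I)
    (hat : a < t) (hI : Icc a t ⊆ I) (hb : Bornology.IsBounded (A a)) (hne : (A t).Nonempty) :
    6 ≤ 3 * circumradius (A a) ^ 2 / (t - a) := by
  rw [le_div_iff₀ (sub_pos.2 hat)]
  linarith [hA.two_mul_sub_le_circumradius_sq hf hat.le hI hb hne]

theorem mem_image_fhat (hf : IsSpeed f) (hv : DualVanishesOnBoundary f)
    (hA : IsInnerBarrier f A I) (hat : a < t) (hI : Icc a t ⊆ I) (hb : Bornology.IsBounded (A a))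
    (hne : (A t).Nonempty) :
    3 * circumradius (A a) ^ 2 / (t - a) ∈ fhat f '' Ioi 0 :=
  hf.Ici_one_subset_image_fhat hv (le_trans (by norm_num)
    (hA.six_le_three_mul_circumradius_sq_div hf hat hI hb hne))

theorem supportFn_le (hf : IsSpeed f) (hv : DualVanishesOnBoundary f) (hA : IsInnerBarrier f A I)
    (hat : a < t) (hI : Icc a t ⊆ I) (hb : Bornology.IsBounded (A a)) (hne : (A t).Nonempty)
    {z : Space n} (hz : ‖z‖ = 1) :
    supportFn (A t) z ≤ supportFn (A a) z - circumradius (A a) *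
      3 ^ (-chi f (3 * circumradius (A a) ^ 2 / (t - a))) := by
  have hR := hA.circumradius_pos hf hat hI hb hne
  have hsix := hA.six_le_three_mul_circumradius_sq_div hf hat hI hb hne
  have hmem := hA.mem_image_fhat hf hv hat hI hb hne
  have hχ := hsix.trans (hf.le_chi (by linarith) hmem)
  have hfχ : fhat f (chi f _) = _ := Function.invFunOn_eq hmem
  set R := circumradius (A a)
  set χ := chi f (3 * R ^ 2 / (t - a))
  have hR_lt : R < R * (1 + 1 / (20 * χ)) :=
    lt_mul_of_one_lt_right hR (lt_add_of_pos_right 1 (by positivity))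
  obtain ⟨c, hc⟩ := exists_subset_closedBall hb hR_lt
  have hcyl : ∀ τ ∈ Icc a t, ∀ p ∈ A τ,
      axisDistSq c z p ≤ (R * (1 + 1 / (20 * χ))) ^ 2 := fun τ hτ p hp => by
    have hpc := mem_closedBall_iff_norm.1 <| hA.subset_closedBall hf hτ.1
      ((Icc_subset_Icc_right hτ.2).trans hI) (hR.trans hR_lt) hc hp
    calc axisDistSq c z p ≤ ‖p - c‖ ^ 2 := sub_le_self _ (sq_nonneg _)
      _ ≤ (R * (1 + 1 / (20 * χ))) ^ 2 := by gcongr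
  refine csSup_le (hne.image _) ?_
  rintro _ ⟨p, hp, rfl⟩
  exact hA.inner_le_sub_three_rpow hf hat hI hz hR (by linarith) hfχ hcyl
    (fun q hq => inner_le_supportFn hb z hq) p hp

end IsInnerBarrier

end CurvatureFlow

theorem theorem11_general {n : ℕ} {f : (Fin n → ℝ) → ℝ} (hf : CurvatureFlow.IsSpeed f) :
    (CurvatureFlow.DualVanishesOnBoundary f →
      ∀ (T : ℝ) (Ω : ℝ → Set (CurvatureFlow.Space n)),
        CurvatureFlow.IsInnerBarrier f Ω (Set.Icc 0 T) →
        Bornology.IsBounded (Ω 0) →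
        ∀ t : ℝ, 0 < t → t ≤ T → (Ω t).Nonempty →
          Bornology.IsBounded (Ω t) ∧
          3 * CurvatureFlow.circumradius (Ω 0) ^ 2 / t ∈ CurvatureFlow.fhat f '' Set.Ioi 0 ∧
          ∀ z : CurvatureFlow.Space n, ‖z‖ = 1 →
            CurvatureFlow.supportFn (Ω t) z ≤ CurvatureFlow.supportFn (Ω 0) z -
              CurvatureFlow.circumradius (Ω 0) *
                (3 : ℝ) ^ (-CurvatureFlow.chi f (3 * CurvatureFlow.circumradius (Ω 0) ^ 2 / t)))
    ∧
    (¬ CurvatureFlow.DualVanishesOnBoundary f →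
      ∃ C : ℝ, 0 < C ∧
        ∀ (T : ℝ) (Ω : ℝ → Set (CurvatureFlow.Space n)),
          CurvatureFlow.IsBarrierSolution f Ω (Set.Icc 0 T) →
          Bornology.IsBounded (Ω 0) →
          ∀ (z y₀ : CurvatureFlow.Space n) (r : ℝ), ‖z‖ = 1 → 0 < r →
            y₀ ∈ frontier (Ω 0) →
            inner ℝ y₀ z = CurvatureFlow.supportFn (Ω 0) z →
            Metric.ball y₀ r ∩ {y | inner ℝ y z < CurvatureFlow.supportFn (Ω 0) z} ⊆ Ω 0 →
            ∀ t : ℝ, 0 ≤ t → t ≤ min (C * r ^ 2) T → y₀ ∈ frontier (Ω t)) := by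
  constructor
  · intro hv T Ω hΩ hb t ht htT hne
    have hI : Icc 0 t ⊆ Icc 0 T := Icc_subset_Icc_right htT
    have hmem := hΩ.mem_image_fhat hf hv ht hI hb hne
    have hsupp := fun z => hΩ.supportFn_le hf hv ht hI hb hne (z := z)
    simp only [sub_zero] at hmem hsupp
    exact ⟨hΩ.isBounded hf ht.le hI hb, hmem, hsupp⟩
  · intro hv
    obtain ⟨K, hK⟩ := hf.exists_fhat_le hv
    have hK₀ : 0 < K := (hf.fhat_pos one_pos).trans_le (hK 1 one_pos)
    refine ⟨1 / (16 * K), by positivity,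
      fun T Ω hΩ hb z y₀ r hz hr hfr hy₀ hball t ht htle => ?_⟩
    obtain ⟨htr, htT⟩ := le_min_iff.1 htle
    rcases ht.eq_or_lt with rfl | ht
    · exact hfr
    rw [div_mul_eq_mul_div, one_mul, le_div_iff₀ (by positivity)] at htr
    rw [← hy₀] at hball
    exact hΩ.mem_frontier hf hK ht (Icc_subset_Icc_right htT) hb hz hr
      (fun p hp => hy₀ ▸ CurvatureFlow.inner_le_supportFn hb z hp) hball
      (by nlinarith [pow_pos hr 2])

theorem theorem11 (n : ℕ) (hn : 1 ≤ n) (f : (Fin n → ℝ) → ℝ) (hf : CurvatureFlow.IsSpeed f) :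
    (CurvatureFlow.DualVanishesOnBoundary f →
      ∀ (T : ℝ) (Ω : ℝ → Set (CurvatureFlow.Space n)),
        CurvatureFlow.IsBarrierSolution f Ω (Set.Icc 0 T) →
        Bornology.IsBounded (Ω 0) → Convex ℝ (Ω 0) → (interior (Ω 0)).Nonempty →
        ∀ t : ℝ, 0 < t → t ≤ T → (Ω t).Nonempty →
          Bornology.IsBounded (Ω t) ∧
          3 * CurvatureFlow.circumradius (Ω 0) ^ 2 / t ∈ CurvatureFlow.fhat f '' Set.Ioi 0 ∧
          ∀ z : CurvatureFlow.Space n, ‖z‖ = 1 →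
            CurvatureFlow.supportFn (Ω t) z ≤ CurvatureFlow.supportFn (Ω 0) z -
              CurvatureFlow.circumradius (Ω 0) *
                (3 : ℝ) ^ (-CurvatureFlow.chi f (3 * CurvatureFlow.circumradius (Ω 0) ^ 2 / t)))
    ∧
    (¬ CurvatureFlow.DualVanishesOnBoundary f →
      ∃ C : ℝ, 0 < C ∧
        ∀ (T : ℝ) (Ω : ℝ → Set (CurvatureFlow.Space n)),
          CurvatureFlow.IsBarrierSolution f Ω (Set.Icc 0 T) →
          Bornology.IsBounded (Ω 0) → Convex ℝ (Ω 0) →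
          ∀ (z y₀ : CurvatureFlow.Space n) (r : ℝ), ‖z‖ = 1 → 0 < r →
            y₀ ∈ frontier (Ω 0) →
            inner ℝ y₀ z = CurvatureFlow.supportFn (Ω 0) z →
            Metric.ball y₀ r ∩ {y | inner ℝ y z < CurvatureFlow.supportFn (Ω 0) z} ⊆ Ω 0 →
            ∀ t : ℝ, 0 ≤ t → t ≤ min (C * r ^ 2) T → y₀ ∈ frontier (Ω t)) := by
  obtain ⟨hmove, hstay⟩ := theorem11_general hf
  exact ⟨fun hv T Ω hΩ hb _ _ => hmove hv T Ω hΩ.2 hb,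
    fun hv => (hstay hv).imp fun _ hC => ⟨hC.1, fun T Ω hΩ hb _ => hC.2 T Ω hΩ hb⟩⟩
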